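/- Let $D>1$ be a square-free integer, $K=\mathbb{Q}(\sqrt D)\subset\mathbb{R}$, with conjugation $a\mapsto\bar a$, ring of integers $\mathcal{O}_K$, and fundamental unit $\varepsilon>1$. Put $\alpha_K=\frac{1+\sqrt D}{2}$ if $D\equiv 1\pmod 4$ and $\alpha_K=\sqrt D$ otherwise. Identify $V_K=K\otimes_{\mathbb{Q}}\mathbb{R}$ with $\mathbb{R}\times\mathbb{R}$ through $a\otimes 1\mapsto(\bar a,a)$, so that $\mathcal{O}_K$ is a lattice in $V_K$, and let $\mathbb{T}_K=V_K/\mathcal{O}_K$. Let $\mathbf{N}(s,u)=|su|$, let $\phi$ be the automorphism of $\mathbb{T}_K$ induced by multiplication by $\varepsilon$, that is by $(s,u)\mapsto(\bar\varepsilon s,\varepsilon u)$, let $M(P)=\inf_{Q\in\mathcal{O}_K}\mathbf{N}(P-Q)$, a function on $\mathbb{T}_K$, and let $X_t=\{P\in\mathbb{T}_K : M(P)\ge t\}$. Let $R_0=(0,-\overline{\alpha_K})\times(0,1)$ and $R_1=(-1,0)\times(0,\alpha_K)$ in the coordinates $(s,u)$; these open rectangles project injectively to $\mathbb{T}_K$.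 Let $\mathcal{P}_0=\{R_0,R_1\}$ if $D=5$, and otherwise let $\mathcal{P}_0$ be the set of connected components of the sets $A\cap\phi^{-1}(B)$ with $A,B\in\{R_0,R_1\}$. This is a Markov generator for $\phi$. Let $\Sigma\subseteq\mathcal{P}_0^{\mathbb{Z}}$ be the set of strings $s$ with $s_i\cap\phi^{-1}(s_{i+1})\ne\emptyset$ for all $i\in\mathbb{Z}$, and let $\pi:\Sigma\to\mathbb{T}_K$ be the coding map, for which $\pi(s)$ is the unique point of $\bigcap_{n}\overline{\bigcap_{i=-n}^{n}\phi^{-i}(s_i)}$. For $n\ge 0$ let $\mathcal{P}_n$ be the set of nonempty intersections $\phi^{n}(A_{-n})\cap\cdots\cap A_0\cap\cdots\cap\phi^{-n}(A_n)$ with $A_i\in\mathcal{P}_0$; such an intersection has the coordinate word $A_{-n}\cdots A_0\cdots A_n$, and is represented in $V_K$ by the part of $R_0\cup R_1$ that lies over it. For a set $\mathcal{C}\subseteq\bigcup_n\mathcal{P}_n$ let $\Sigma\langle\mathcal{C}\rangle$ be the set of $s\in\Sigma$ in which no coordinate word of a member of $\mathcal{C}$ occurs. For a finite set $I\subseteq\mathcal{O}_K$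 let $\mathcal{U}(t,I)=\bigcup_{Q\in I}\{P\in V_K : \mathbf{N}(P-Q)<t\}$, and let $\mathcal{T}_n(t,I)$ be the set of those $A\in\mathcal{P}_n$ for which the closure in $V_K$ of the representative of $A$ is contained in $\mathcal{U}(t,I)$. There is a finite set $I_K\subseteq\mathcal{O}_K$ such that for every finite set $I$ with $I_K\subseteq I\subseteq\mathcal{O}_K$ the following holds. If $t>0$ and $X_t=X_{t-\eta}$ for some $\eta>0$, then $\pi^{-1}(X_t)$ is a subshift of finite type over the finite alphabet $\mathcal{P}_0$ (the set of all strings in $\mathcal{P}_0^{\mathbb{Z}}$ in which none of finitely many forbidden words occurs), and $\pi^{-1}(X_t)=\Sigma\langle\mathcal{T}_n(t,I)\rangle$ for some $n\in\mathbb{N}$. -/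

import Mathlib

open Set Topology

noncomputable section

namespace QuadTorus

/-! ### The real quadratic field, its integers, and the torus -/

/-- `K = ℚ(√D)`, as `ℚ[ω]` with `ω ^ 2 = D`; Galois conjugation is `star`. -/
abbrev K (D : ℕ) : Type := QuadraticAlgebra ℚ (D : ℚ) 0

/-- The ring of integers of `K`: the integral closure of `ℤ` in `K`. -/
abbrev O (D : ℕ) : Subalgebra ℤ (K D) := integralClosure ℤ (K D)

/-- The embedding of `K` in `ℝ` that sends `ω` to the positive square root of `D`. -/
def realEmb (D : ℕ) : K D →ₐ[ℚ] ℝ :=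
  QuadraticAlgebra.lift ⟨√(D : ℝ), by
    rw [Real.mul_self_sqrt (Nat.cast_nonneg D)]; simp [Algebra.smul_def]⟩

/-- The embedding `a ↦ (ā, a)` of `K` in `V_K = K ⊗ ℝ ≅ ℝ × ℝ`, in stable and unstable
coordinates `(s, u)`. -/
def embed (D : ℕ) : K D →+* ℝ × ℝ :=
  ((realEmb D).toRingHom.comp (starRingEnd (K D))).prod (realEmb D).toRingHom

/-- The ring of integers as a lattice in `V_K`. -/
def lattice (D : ℕ) : AddSubgroup (ℝ × ℝ) :=
  (O D).toSubring.toAddSubgroup.map (embed D).toAddMonoidHom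

/-- The torus `𝕋_K = V_K / O_K`. -/
abbrev Torus (D : ℕ) : Type := (ℝ × ℝ) ⧸ lattice D

/-- The projection `V_K → 𝕋_K`. -/
def proj (D : ℕ) (v : ℝ × ℝ) : Torus D := QuotientAddGroup.mk v

/-- The extension of the absolute norm to `V_K`. -/
def absNorm (v : ℝ × ℝ) : ℝ := |v.1 * v.2|

/-- `absNorm` restricts to the absolute norm of the field. -/
theorem absNorm_embed (D : ℕ) (a : K D) :
    absNorm (embed D a) = |((QuadraticAlgebra.norm a : ℚ) : ℝ)| := by
  have h : realEmb D (algebraMap ℚ (K D) (QuadraticAlgebra.norm a)) =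
      realEmb D (star a) * realEmb D a := by
    rw [← map_mul, mul_comm, QuadraticAlgebra.algebraMap_norm_eq_mul_star]
  rw [AlgHom.commutes] at h
  exact congrArg abs h.symm

/-- `M(P) = inf_{Q ∈ O_K} N(P - Q)` on `V_K`. -/
def euclMinV (D : ℕ) (v : ℝ × ℝ) : ℝ := ⨅ q : lattice D, absNorm (v - q)

theorem euclMinV_sub (D : ℕ) (v : ℝ × ℝ) (r : lattice D) :
    euclMinV D (v - r) = euclMinV D v := by
  unfold euclMinV
  refine Equiv.iInf_congr (Equiv.addLeft r) fun q => ?_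
  simp [sub_sub]

/-- The function `M` on the torus. -/
def euclMin (D : ℕ) (P : Torus D) : ℝ :=
  Quotient.liftOn' P (euclMinV D) fun a b h => by
    have h' : -a + b ∈ lattice D := QuotientAddGroup.leftRel_apply.mp h
    have := euclMinV_sub D b ⟨-a + b, h'⟩
    simpa using this

/-- `X_t`, the set of points of the torus with `M(P) ≥ t`. -/
def X (D : ℕ) (t : ℝ) : Set (Torus D) := {P | t ≤ euclMin D P}

/-! ### The dynamical system -/

/-- `ε` is the fundamental unit with `ε > 1`. -/
def IsFundamentalUnit (D : ℕ) (ε : (O D)ˣ) : Prop :=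
  1 < realEmb D (ε : O D) ∧ ∀ u : (O D)ˣ, ∃ k : ℤ, u = ε ^ k ∨ u = -ε ^ k

/-- `ε` as a unit of the ring `ℝ × ℝ`, that is `(ε̄, ε)`. -/
def unitV (D : ℕ) (ε : (O D)ˣ) : (ℝ × ℝ)ˣ :=
  Units.map ((embed D).comp (O D).subtype).toMonoidHom ε

/-- `φ` on `V_K`: multiplication by `ε`. -/
def phiV (D : ℕ) (ε : (O D)ˣ) : (ℝ × ℝ) ≃+ (ℝ × ℝ) :=
  { (unitV D ε).mulLeft with map_add' := fun v w => mul_add (unitV D ε : ℝ × ℝ) v w }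

theorem phiV_embed (D : ℕ) (ε : (O D)ˣ) (a : K D) :
    phiV D ε (embed D a) = embed D ((ε : O D) * a) := (map_mul (embed D) _ _).symm

theorem map_phiV (D : ℕ) (ε : (O D)ˣ) :
    (lattice D).map (phiV D ε).toAddMonoidHom = lattice D := by
  ext v
  constructor
  · rintro ⟨_, ⟨a, ha, rfl⟩, rfl⟩
    exact ⟨_, (O D).mul_mem (ε : O D).2 ha, (phiV_embed D ε a).symm⟩
  · rintro ⟨a, ha, rfl⟩
    refine ⟨_, ⟨(ε⁻¹ : (O D)ˣ) * a, (O D).mul_mem ((ε⁻¹ : (O D)ˣ) : O D).2 ha, rfl⟩, ?_⟩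
    refine (phiV_embed D ε _).trans ?_
    have h : ((ε : O D) : K D) * (((ε⁻¹ : (O D)ˣ) : O D) : K D) = 1 := by
      exact_mod_cast congrArg (Subtype.val) (Units.mul_inv ε)
    rw [← mul_assoc, h, one_mul]
    rfl

/-- `φ` on the torus. -/
def phi (D : ℕ) (ε : (O D)ˣ) : Equiv.Perm (Torus D) :=
  (QuotientAddGroup.congr (lattice D) (lattice D) (phiV D ε) (map_phiV D ε)).toEquiv

/-! ### The Markov generator -/

/-- `α_K`, the second element of the standard integral basis `1, α_K`. -/
def alphaK (D : ℕ) : K D := if D % 4 = 1 then ⟨1 / 2, 1 / 2⟩ else ⟨0, 1⟩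

/-- `α_K` as a real number. -/
def al (D : ℕ) : ℝ := realEmb D (alphaK D)

/-- The conjugate of `α_K` as a real number. -/
def alBar (D : ℕ) : ℝ := realEmb D (star (alphaK D))

/-- The open rectangle with corners `(0, 0)` and `(-ᾱ_K, 1)` in `(s, u)`-coordinates. -/
def R0 (D : ℕ) : Set (ℝ × ℝ) := Ioo 0 (-alBar D) ×ˢ Ioo 0 1

/-- The open rectangle with corners `(-1, 0)` and `(0, α_K)` in `(s, u)`-coordinates. -/
def R1 (D : ℕ) : Set (ℝ × ℝ) := Ioo (-1) 0 ×ˢ Ioo 0 (al D)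

/-- The part of the planar set `A` lying over `φ⁻¹(B)`. -/
def overlap (D : ℕ) (ε : (O D)ˣ) (A B : Set (ℝ × ℝ)) : Set (ℝ × ℝ) :=
  {v ∈ A | phi D ε (proj D v) ∈ proj D '' B}

/-- The Markov generator `𝒫₀`. Its members are listed by their planar representatives inside
`R₀ ∪ R₁`, on which `proj` is injective and open. For `D = 5` it is `{R₀, R₁}`; otherwise it
consists of the connected components of the sets `A ∩ φ⁻¹(B)`, with `A, B ∈ {R₀, R₁}`. -/
def P0 (D : ℕ) (ε : (O D)ˣ) : Set (Set (ℝ × ℝ)) :=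
  if D = 5 then {R0 D, R1 D}
  else {C | ∃ A ∈ ({R0 D, R1 D} : Set (Set (ℝ × ℝ))),
    ∃ B ∈ ({R0 D, R1 D} : Set (Set (ℝ × ℝ))),
    ∃ v ∈ overlap D ε A B, C = connectedComponentIn (overlap D ε A B) v}

/-- The alphabet of the symbolic coding. -/
abbrev Letter (D : ℕ) (ε : (O D)ˣ) : Type := ↥(P0 D ε)

/-- The member of the partition of the torus named by a letter. -/
def tset (D : ℕ) (ε : (O D)ˣ) (A : Letter D ε) : Set (Torus D) := proj D '' (A : Set (ℝ × ℝ))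

/-! ### Symbolic coding -/

/-- `Σ`, the bi-infinite strings all of whose transitions `A B` are admissible, that is
`A ∩ φ⁻¹(B) ≠ ∅`. -/
def Sig (D : ℕ) (ε : (O D)ˣ) : Set (ℤ → Letter D ε) :=
  {s | ∀ i : ℤ, (tset D ε (s i) ∩ phi D ε ⁻¹' tset D ε (s (i + 1))).Nonempty}

/-- `⋂ₙ closure (⋂_{|i| ≤ n} φ⁻ⁱ(s_i))`. -/
def codingSet (D : ℕ) (ε : (O D)ˣ) (s : ℤ → Letter D ε) : Set (Torus D) :=
  ⋂ n : ℕ, closure (⋂ i ∈ Icc (-(n : ℤ)) n, {P | (phi D ε ^ i) P ∈ tset D ε (s i)})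

/-- The coding map: `π(s)` is the point `P` with `codingSet s = {P}`. -/
def piMap (D : ℕ) (ε : (O D)ˣ) (s : ℤ → Letter D ε) : Torus D :=
  Classical.epsilon fun P => codingSet D ε s = {P}

/-- `π⁻¹(Y)`, a subset of `Σ`. -/
def piInv (D : ℕ) (ε : (O D)ˣ) (Y : Set (Torus D)) : Set (ℤ → Letter D ε) :=
  {s ∈ Sig D ε | piMap D ε s ∈ Y}

/-- Words `A₋ₙ ⋯ A₀ ⋯ Aₙ`. -/
abbrev Word (D : ℕ) (ε : (O D)ˣ) (n : ℕ) : Type := Icc (-(n : ℤ)) n → Letter D ε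

/-- The planar representative, inside `R₀ ∪ R₁`, of
`φⁿ(A₋ₙ) ∩ ⋯ ∩ A₀ ∩ ⋯ ∩ φ⁻ⁿ(Aₙ)`. -/
def cell (D : ℕ) (ε : (O D)ˣ) (n : ℕ) (w : Word D ε n) : Set (ℝ × ℝ) :=
  {v ∈ (w ⟨0, by simp⟩ : Set (ℝ × ℝ)) | ∀ i : Icc (-(n : ℤ)) n, (phi D ε ^ (i : ℤ)) (proj D v) ∈ tset D ε (w i)}

/-- The refinement `𝒫ₙ`: the nonempty cells at level `n`. -/
def Pn (D : ℕ) (ε : (O D)ˣ) (n : ℕ) : Set (Set (ℝ × ℝ)) :=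
  {A | A.Nonempty ∧ ∃ w : Word D ε n, A = cell D ε n w}

/-- `Σ⟨𝒞⟩`: the strings in `Σ` in which no coordinate word of a member of `𝒞` occurs. -/
def avoid (D : ℕ) (ε : (O D)ˣ) (C : Set (Set (ℝ × ℝ))) : Set (ℤ → Letter D ε) :=
  {s ∈ Sig D ε | ∀ (n : ℕ) (w : Word D ε n), cell D ε n w ∈ C →
    ¬ ∃ k : ℤ, ∀ i : Icc (-(n : ℤ)) n, s (k + (i : ℤ)) = w i}

/-- `𝒰(t, I)`, the points of `V_K` at norm-distance less than `t` from a member of `I`. -/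
def U (D : ℕ) (t : ℝ) (I : Finset (O D)) : Set (ℝ × ℝ) :=
  {v | ∃ q ∈ I, absNorm (v - embed D q) < t}

/-- `𝒯ₙ(t, I)`, the members of `𝒫ₙ` with closure contained in `𝒰(t, I)`. -/
def Tn (D : ℕ) (ε : (O D)ˣ) (n : ℕ) (t : ℝ) (I : Finset (O D)) : Set (Set (ℝ × ℝ)) :=
  {A ∈ Pn D ε n | closure A ⊆ U D t I}

/-- A subshift of finite type over the finite alphabet `α`: the set of all bi-infinite strings
in which none of the words of a finite list of forbidden words occurs. -/
def IsSFT {α : Type*} (Y : Set (ℤ → α)) : Prop :=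
  Finite α ∧ ∃ F : Set (List α), F.Finite ∧
    Y = {s | ∀ w ∈ F, ¬ ∃ k : ℤ, ∀ j : Fin w.length, s (k + (j : ℕ)) = w.get j}

end QuadTorus

end

/-!
Modulo the lattice, the sides of the two rectangles lie on one segment of the stable direction and
one of the unstable direction, which `φ` and `φ⁻¹` respectively map into themselves. Hence a letter
followed by an admissible one is crossed from side to side, and every admissible word has a nonempty
cell. For two consecutive letters the lattice translation matching their lifts is determined by the
letters (for `D = 5`, where the letters are the rectangles themselves, because of their shape), so
a cell of level `n` has diameter `O(ε⁻ⁿ)` in the plane and the coding map is well defined.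

If `M(P) < t - η`, a power of `φ` balances the two coordinates of `P - Q` for a lattice point `Q`
witnessing this. Then `Q` is at bounded distance, so it lies in a finite set depending on `K` only,
and a cell around the moved point that is small in terms of `η` lies in `{N(· - Q) < t}`.
Conversely, a cell covered by `U(t, I)` codes only points with `M < t`.
-/

noncomputable section

namespace QuadTorus

variable {D : ℕ}

/-! ### The ring of integers -/

theorem realEmb_mk (D : ℕ) (x y : ℚ) : realEmb D ⟨x, y⟩ = x + y * √(D : ℝ) := by
  simp [realEmb, QuadraticAlgebra.lift, Algebra.smul_def]

theorem embed_mk (D : ℕ) (x y : ℚ) :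
    embed D ⟨x, y⟩ = (x - y * √(D : ℝ), x + y * √(D : ℝ)) := by
  have h : embed D ⟨x, y⟩ = (realEmb D (star ⟨x, y⟩), realEmb D ⟨x, y⟩) := rfl
  rw [h, QuadraticAlgebra.star_mk, realEmb_mk, realEmb_mk]
  simp [sub_eq_add_neg]

theorem isIntegral_star {a : K D} (ha : IsIntegral ℤ a) : IsIntegral ℤ (star a) :=
  ha.map (starRingEnd (K D)).toIntAlgHom

theorem exists_int_of_isIntegral_algebraMap {x : ℚ}
    (h : IsIntegral ℤ (algebraMap ℚ (K D) x)) : ∃ m : ℤ, (m : ℚ) = x :=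
  IsIntegrallyClosed.isIntegral_iff.mp
    ((isIntegral_algebraMap_iff (algebraMap ℚ (K D)).injective).mp h)

theorem exists_int_eq_norm {a : K D} (ha : IsIntegral ℤ a) :
    ∃ m : ℤ, (m : ℚ) = QuadraticAlgebra.norm a := by
  apply exists_int_of_isIntegral_algebraMap (D := D)
  rw [QuadraticAlgebra.algebraMap_norm_eq_mul_star]
  exact ha.mul (isIntegral_star ha)

theorem exists_int_eq_two_mul_re {a : K D} (ha : IsIntegral ℤ a) :
    ∃ m : ℤ, (m : ℚ) = 2 * a.re := by
  apply exists_int_of_isIntegral_algebraMap (D := D)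
  have htrace := QuadraticAlgebra.algebraMap_trace_eq_add_star (z := a)
  rw [QuadraticAlgebra.trace_def, zero_mul, add_zero] at htrace
  rw [htrace]
  exact ha.add (isIntegral_star ha)

theorem exists_int_of_mul_sq (hsq : Squarefree D) {z : ℚ} {c : ℤ} (h : (D : ℚ) * z ^ 2 = c) :
    ∃ n : ℤ, (n : ℚ) = z := by
  obtain ⟨k, hk⟩ : ∃ k : ℤ, (k : ℚ) = D * z := by
    refine IsIntegrallyClosed.isIntegral_iff.mp (IsIntegral.of_pow (n := 2) two_pos ?_)
    have : ((D : ℚ) * z) ^ 2 = algebraMap ℤ ℚ (D * c) := by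
      rw [eq_intCast]; push_cast; rw [← h]; ring
    rw [this]
    exact isIntegral_algebraMap
  have hk2 : k ^ 2 = D * c := by
    have : (k : ℚ) ^ 2 = D * c := by rw [hk, ← h]; ring
    exact_mod_cast this
  obtain ⟨n, rfl⟩ : (D : ℤ) ∣ k :=
    ((Int.squarefree_natCast.mpr hsq).dvd_pow_iff_dvd two_ne_zero).mp ⟨c, hk2⟩
  refine ⟨n, mul_left_cancel₀ (Nat.cast_ne_zero.mpr hsq.ne_zero : (D : ℚ) ≠ 0) ?_⟩
  rw [← hk]; push_cast; rfl

theorem exists_int_half_coords (hsq : Squarefree D) {a : K D} (ha : IsIntegral ℤ a) :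
    ∃ A B C : ℤ, a.re = A / 2 ∧ a.im = C / 2 ∧ A ^ 2 - D * C ^ 2 = 4 * B := by
  obtain ⟨A, hA⟩ := exists_int_eq_two_mul_re ha
  obtain ⟨B, hB⟩ := exists_int_eq_norm ha
  rw [QuadraticAlgebra.norm_def] at hB
  obtain ⟨C, hC⟩ : ∃ C : ℤ, (C : ℚ) = 2 * a.im := by
    refine exists_int_of_mul_sq hsq (c := A ^ 2 - 4 * B) ?_
    push_cast; rw [hA, hB]; ring
  have hABC : (A : ℚ) ^ 2 - D * C ^ 2 = 4 * B := by rw [hA, hB, hC]; ring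
  exact ⟨A, B, C, by rw [hA]; ring, by rw [hC]; ring, by exact_mod_cast hABC⟩

theorem even_sub_of_sq_sub_mul_sq {d A B C : ℤ} (hd : Odd d) (h : A ^ 2 - d * C ^ 2 = 4 * B) :
    Even (A - C) := by
  have heven : Even (A ^ 2 - d * C ^ 2) := ⟨2 * B, by rw [h]; ring⟩
  simpa [parity_simps, Int.not_even_iff_odd.mpr hd] using heven

theorem even_and_even_of_sq_sub_mul_sq {d A B C : ℤ} (hd : d % 4 = 2 ∨ d % 4 = 3)
    (h : A ^ 2 - d * C ^ 2 = 4 * B) : Even A ∧ Even C := by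
  obtain ⟨k, r, rfl, hr⟩ : ∃ k r, d = 4 * k + r ∧ (r = 2 ∨ r = 3) :=
    ⟨d / 4, d % 4, by omega, hd⟩
  obtain ⟨a, rfl | rfl⟩ := Int.even_or_odd' A <;> obtain ⟨c, rfl | rfl⟩ := Int.even_or_odd' C
  · exact ⟨even_two_mul a, even_two_mul c⟩
  all_goals exfalso; rcases hr with rfl | rfl <;> ring_nf at h <;> omega

theorem exists_int_combo_of_isIntegral (hsq : Squarefree D) {a : K D} (ha : IsIntegral ℤ a) :
    ∃ m n : ℤ, a = m + n * alphaK D := by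
  obtain ⟨A, B, C, hre, him, hABC⟩ := exists_int_half_coords hsq ha
  by_cases h1 : D % 4 = 1
  · obtain ⟨m, hm⟩ := even_sub_of_sq_sub_mul_sq (by rw [Int.odd_iff]; omega) hABC
    obtain rfl : A = m + m + C := by omega
    have hα : alphaK D = ⟨1 / 2, 1 / 2⟩ := if_pos h1
    refine ⟨m, C, QuadraticAlgebra.ext ?_ ?_⟩
    · simp only [hα, hre, QuadraticAlgebra.re_add, QuadraticAlgebra.re_mul,
        QuadraticAlgebra.re_intCast, QuadraticAlgebra.im_intCast]
      push_cast
      ring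
    · simp only [hα, him, QuadraticAlgebra.im_add, QuadraticAlgebra.im_mul,
        QuadraticAlgebra.re_intCast, QuadraticAlgebra.im_intCast]
      ring
  · have h0 : D % 4 ≠ 0 := fun h => by
      simpa using hsq 2 (Nat.dvd_of_mod_eq_zero h)
    obtain ⟨⟨m, rfl⟩, n, rfl⟩ := even_and_even_of_sq_sub_mul_sq (by omega) hABC
    refine ⟨m, n, QuadraticAlgebra.ext ?_ ?_⟩ <;> simp [alphaK, h1, hre, him]

theorem isIntegral_alphaK (D : ℕ) : IsIntegral ℤ (alphaK D) := by
  by_cases h : D % 4 = 1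
  · obtain ⟨k, rfl⟩ : ∃ k : ℕ, D = 4 * k + 1 := ⟨D / 4, by omega⟩
    have hmonic : (Polynomial.X ^ 2 - (Polynomial.X + Polynomial.C (k : ℤ))).Monic :=
      Polynomial.monic_X_pow_sub
        ((Polynomial.degree_X_add_C (k : ℤ)).trans_lt (by exact_mod_cast one_lt_two))
    refine ⟨_, hmonic, ?_⟩
    rw [← Polynomial.aeval_def]
    simp only [alphaK, if_pos h, pow_two, map_sub, map_add, map_mul, Polynomial.aeval_X,
      map_natCast, QuadraticAlgebra.mk_mul_mk]
    ext
    · simp only [QuadraticAlgebra.re_sub, QuadraticAlgebra.re_add, QuadraticAlgebra.re_natCast,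
        QuadraticAlgebra.re_zero]
      push_cast
      ring
    · simp only [QuadraticAlgebra.im_sub, QuadraticAlgebra.im_add, QuadraticAlgebra.im_natCast,
        QuadraticAlgebra.im_zero]
      ring
  · refine IsIntegral.of_pow two_pos ?_
    have : alphaK D ^ 2 = algebraMap ℤ (K D) D := by
      ext <;> simp [alphaK, h, pow_two]
    rw [this]
    exact isIntegral_algebraMap

theorem embed_alphaK (D : ℕ) : embed D (alphaK D) = (alBar D, al D) := rfl

theorem embed_int_combo (D : ℕ) (m n : ℤ) :
    embed D (m + n * alphaK D) = (m + n * alBar D, m + n * al D) := by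
  rw [map_add, map_mul, embed_alphaK, map_intCast, map_intCast]
  rfl

theorem mem_lattice_iff (hsq : Squarefree D) {v : ℝ × ℝ} :
    v ∈ lattice D ↔ ∃ m n : ℤ, v = (m + n * alBar D, m + n * al D) := by
  constructor
  · rintro ⟨a, ha, rfl⟩
    obtain ⟨m, n, rfl⟩ := exists_int_combo_of_isIntegral hsq ha
    exact ⟨m, n, embed_int_combo D m n⟩
  · rintro ⟨m, n, rfl⟩
    exact ⟨m + n * alphaK D, (O D).add_mem ((O D).intCast_mem m)
      ((O D).mul_mem ((O D).intCast_mem n) (isIntegral_alphaK D)), embed_int_combo D m n⟩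

theorem embed_mem_lattice (q : O D) : embed D q ∈ lattice D := ⟨q, q.2, rfl⟩

theorem exists_embed_eq {v : ℝ × ℝ} (h : v ∈ lattice D) : ∃ q : O D, embed D q = v := by
  obtain ⟨a, ha, rfl⟩ := h
  exact ⟨⟨a, ha⟩, rfl⟩

theorem one_mem_lattice (D : ℕ) : ((1, 1) : ℝ × ℝ) ∈ lattice D :=
  ⟨1, (O D).one_mem, map_one (embed D)⟩

theorem alphaK_mem_lattice (D : ℕ) : (alBar D, al D) ∈ lattice D :=
  ⟨alphaK D, isIntegral_alphaK D, rfl⟩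

theorem embed_injective (hD : D ≠ 0) : Function.Injective (embed D) := by
  intro ⟨x, y⟩ ⟨x', y'⟩ h
  rw [embed_mk, embed_mk, Prod.mk.injEq] at h
  have hroot : √(D : ℝ) ≠ 0 := by positivity
  have hx : (x : ℝ) = x' := by linarith [h.1, h.2]
  have hy : (y : ℝ) = y' := mul_right_cancel₀ hroot (by linarith [h.1, h.2])
  rw [Rat.cast_inj.mp hx, Rat.cast_inj.mp hy]

theorem al_eq (D : ℕ) : al D = if D % 4 = 1 then (1 + √(D : ℝ)) / 2 else √(D : ℝ) := by
  unfold al alphaK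
  split_ifs <;> rw [realEmb_mk] <;> push_cast <;> ring

theorem alBar_eq (D : ℕ) : alBar D = if D % 4 = 1 then (1 - √(D : ℝ)) / 2 else -√(D : ℝ) := by
  unfold alBar alphaK
  split_ifs <;> rw [QuadraticAlgebra.star_mk, realEmb_mk] <;> push_cast <;> ring

theorem one_lt_sqrt (hD : 1 < D) : 1 < √(D : ℝ) :=
  Real.lt_sqrt_of_sq_lt (by rw [one_pow]; exact_mod_cast hD)

theorem one_lt_al (hD : 1 < D) : 1 < al D := by
  rw [al_eq]
  split_ifs <;> linarith [one_lt_sqrt hD]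

theorem alBar_neg (hD : 1 < D) : alBar D < 0 := by
  rw [alBar_eq]
  split_ifs <;> linarith [one_lt_sqrt hD]

theorem neg_alBar_le_al (D : ℕ) : -alBar D ≤ al D := by
  rw [al_eq, alBar_eq]
  split_ifs <;> linarith

theorem one_le_al_mul_neg_alBar (hD : 1 < D) : 1 ≤ al D * -alBar D := by
  have hroot : √(D : ℝ) ^ 2 = D := Real.sq_sqrt (Nat.cast_nonneg D)
  rw [al_eq, alBar_eq]
  split_ifs with h
  · have hD5 : (5 : ℝ) ≤ D := by exact_mod_cast (by omega : 5 ≤ D)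
    linarith
  · have hD1 : (1 : ℝ) ≤ D := by exact_mod_cast hD.le
    linarith

/-! ### The two rectangles -/

/-- The stable side of the rectangle `R₀` (index `false`) or `R₁` (index `true`). -/
def tileS (D : ℕ) : Bool → Set ℝ
  | false => Ioo 0 (-alBar D)
  | true => Ioo (-1) 0

/-- The unstable side of the rectangle `R₀` (index `false`) or `R₁` (index `true`). -/
def tileU (D : ℕ) : Bool → Set ℝ
  | false => Ioo 0 1
  | true => Ioo 0 (al D)

/-- The rectangles `R₀` (index `false`) and `R₁` (index `true`) as one family. -/
def tile (D : ℕ) (b : Bool) : Set (ℝ × ℝ) := tileS D b ×ˢ tileU D b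

theorem mem_rectangles_iff {A : Set (ℝ × ℝ)} :
    A ∈ ({R0 D, R1 D} : Set (Set (ℝ × ℝ))) ↔ ∃ b, A = tile D b := by
  rw [Bool.exists_bool]
  rfl

theorem isOpen_tile (D : ℕ) (b : Bool) : IsOpen (tile D b) := by
  cases b <;> exact isOpen_Ioo.prod isOpen_Ioo

theorem convex_tile (D : ℕ) (b : Bool) : Convex ℝ (tile D b) := by
  cases b <;> exact (convex_Ioo _ _).prod (convex_Ioo _ _)

theorem tileS_nonempty (hD : 1 < D) (b : Bool) : (tileS D b).Nonempty := by
  cases b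
  · exact nonempty_Ioo.mpr (neg_pos.mpr (alBar_neg hD))
  · exact nonempty_Ioo.mpr neg_one_lt_zero

theorem tileU_nonempty (hD : 1 < D) (b : Bool) : (tileU D b).Nonempty := by
  cases b
  · exact nonempty_Ioo.mpr zero_lt_one
  · exact nonempty_Ioo.mpr (zero_lt_one.trans (one_lt_al hD))

theorem norm_le_of_mem_tile (hD : 1 < D) {b : Bool} {v : ℝ × ℝ} (hv : v ∈ tile D b) :
    ‖v‖ ≤ al D := by
  have ha := one_lt_al hD
  have hc := neg_alBar_le_al D
  obtain ⟨hs, hu⟩ := hv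
  rw [norm_prod_le_iff, Real.norm_eq_abs, Real.norm_eq_abs, abs_le, abs_le]
  cases b <;> refine ⟨⟨?_, ?_⟩, ⟨?_, ?_⟩⟩ <;> linarith [hs.1, hs.2, hu.1, hu.2]

/-- A region of the plane that, together with its opposite, contains every nonzero lattice
vector. Differences between points of the two rectangles stay out of it. -/
def farRegion (D : ℕ) : Set (ℝ × ℝ) :=
  {r | (1 ≤ r.1 ∧ 1 ≤ r.2) ∨ (r.1 ≤ alBar D ∧ al D ≤ r.2) ∨ 1 + al D ≤ r.2 ∨ r.1 ≤ alBar D - 1}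

theorem int_combo_mem_farRegion (hD : 1 < D) {m n : ℤ} (h : 0 < n ∨ n = 0 ∧ 0 < m) :
    ((m + n * alBar D, m + n * al D) : ℝ × ℝ) ∈ farRegion D := by
  have ha := one_lt_al hD
  have hb := alBar_neg hD
  rcases h with hn | ⟨rfl, hm⟩
  · have hn : (1 : ℝ) ≤ n := by exact_mod_cast hn
    have hna : al D ≤ n * al D := le_mul_of_one_le_left (by linarith) hn
    have hnb : n * alBar D ≤ alBar D := mul_le_of_one_le_left hb.le hn
    rcases lt_trichotomy m 0 with hm | rfl | hm
    · have hm : (m : ℝ) ≤ -1 := by exact_mod_cast Int.le_sub_one_of_lt hm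
      exact Or.inr (Or.inr (Or.inr (by linarith)))
    · exact Or.inr (Or.inl ⟨by push_cast; linarith, by push_cast; linarith⟩)
    · have hm : (1 : ℝ) ≤ m := by exact_mod_cast hm
      exact Or.inr (Or.inr (Or.inl (by linarith)))
  · have hm : (1 : ℝ) ≤ m := by exact_mod_cast hm
    exact Or.inl ⟨by push_cast; linarith, by push_cast; linarith⟩

theorem mem_farRegion_of_mem_lattice (hD : 1 < D) (hsq : Squarefree D) {r : ℝ × ℝ}
    (hr : r ∈ lattice D) : r = 0 ∨ r ∈ farRegion D ∨ -r ∈ farRegion D := by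
  obtain ⟨m, n, rfl⟩ := (mem_lattice_iff hsq).mp hr
  have hneg : -((m + n * alBar D, m + n * al D) : ℝ × ℝ) =
      ((-m : ℤ) + (-n : ℤ) * alBar D, (-m : ℤ) + (-n : ℤ) * al D) := by
    push_cast
    ext <;> simp only [Prod.fst_neg, Prod.snd_neg] <;> ring
  by_cases h0 : n = 0 ∧ m = 0
  · left
    rw [h0.1, h0.2]
    ext <;> simp
  · by_cases hpos : 0 < n ∨ n = 0 ∧ 0 < m
    · exact Or.inr (Or.inl (int_combo_mem_farRegion hD hpos))
    · right; right
      rw [hneg]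
      exact int_combo_mem_farRegion hD (by omega)

theorem sub_notMem_farRegion (hD : 1 < D) {b b' : Bool} {v v' : ℝ × ℝ} (hv : v ∈ tile D b)
    (hv' : v' ∈ tile D b') : v - v' ∉ farRegion D := by
  have ha := one_lt_al hD
  have hb := alBar_neg hD
  obtain ⟨hs, hu⟩ := hv
  obtain ⟨hs', hu'⟩ := hv'
  rintro (⟨h1, h2⟩ | ⟨h1, h2⟩ | h | h) <;> simp only [Prod.fst_sub, Prod.snd_sub] at * <;>
    cases b <;> cases b' <;> linarith [hs.1, hs.2, hu.1, hu.2, hs'.1, hs'.2, hu'.1, hu'.2]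

theorem eq_of_mem_tile_of_sub_mem (hD : 1 < D) (hsq : Squarefree D) {b b' : Bool}
    {v v' : ℝ × ℝ} (hv : v ∈ tile D b) (hv' : v' ∈ tile D b') (h : v - v' ∈ lattice D) :
    v = v' := by
  rcases mem_farRegion_of_mem_lattice hD hsq h with h | h | h
  · exact sub_eq_zero.mp h
  · exact absurd h (sub_notMem_farRegion hD hv hv')
  · exact absurd (neg_sub v v' ▸ h) (sub_notMem_farRegion hD hv' hv)

theorem index_eq_of_mem_tile {b b' : Bool} {v : ℝ × ℝ} (hv : v ∈ tile D b)
    (hv' : v ∈ tile D b') : b = b' := by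
  cases b <;> cases b' <;> first | rfl | exact absurd (hv.1.1.trans hv'.1.2) (lt_irrefl 0) |
    exact absurd (hv'.1.1.trans hv.1.2) (lt_irrefl 0)

-- Modulo the lattice, the sides `s = const` of both rectangles lie on `{0} × [0, 1 + α_K]`, and
-- the sides `u = const` on the stable segment `[-1, -ᾱ_K] × {0}` of the next lemma.
theorem sub_unstable_segment_notMem_lattice (hD : 1 < D) (hsq : Squarefree D) {b : Bool}
    {v : ℝ × ℝ} (hv : v ∈ tile D b) {y : ℝ} (hy : y ∈ Icc 0 (1 + al D)) :
    v - (0, y) ∉ lattice D := by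
  have ha := one_lt_al hD
  have hb := alBar_neg hD
  obtain ⟨hs, hu⟩ := hv
  obtain ⟨hy0, hy1⟩ := hy
  intro h
  rcases mem_farRegion_of_mem_lattice hD hsq h with h | h | h
  · have hs0 := congrArg Prod.fst h
    simp only [Prod.fst_sub, Prod.fst_zero] at hs0
    cases b <;> linarith [hs.1, hs.2, hu.1, hu.2]
  all_goals
    rcases h with ⟨h, h'⟩ | ⟨h, h'⟩ | h | h <;>
      simp only [Prod.fst_sub, Prod.snd_sub, Prod.fst_neg, Prod.snd_neg] at * <;>
      cases b <;> linarith [hs.1, hs.2, hu.1, hu.2]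

theorem sub_stable_segment_notMem_lattice (hD : 1 < D) (hsq : Squarefree D) {b : Bool}
    {v : ℝ × ℝ} (hv : v ∈ tile D b) {x : ℝ} (hx : x ∈ Icc (-1) (-alBar D)) :
    v - (x, 0) ∉ lattice D := by
  have ha := one_lt_al hD
  have hb := alBar_neg hD
  obtain ⟨hs, hu⟩ := hv
  obtain ⟨hx0, hx1⟩ := hx
  intro h
  rcases mem_farRegion_of_mem_lattice hD hsq h with h | h | h
  · have hu0 := congrArg Prod.snd h
    simp only [Prod.snd_sub, Prod.snd_zero] at hu0
    cases b <;> linarith [hs.1, hs.2, hu.1, hu.2]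
  all_goals
    rcases h with ⟨h, h'⟩ | ⟨h, h'⟩ | h | h <;>
      simp only [Prod.fst_sub, Prod.snd_sub, Prod.fst_neg, Prod.snd_neg] at * <;>
      cases b <;> linarith [hs.1, hs.2, hu.1, hu.2]

theorem discreteTopology_lattice (hD : 1 < D) (hsq : Squarefree D) :
    DiscreteTopology (lattice D) := by
  obtain ⟨s, hs⟩ := tileS_nonempty hD false
  obtain ⟨u, hu⟩ := tileU_nonempty hD false
  have hv : (s, u) ∈ tile D false := ⟨hs, hu⟩
  have hzero : ({0} : Set (lattice D)) = (fun r : lattice D => (r : ℝ × ℝ) + (s, u)) ⁻¹'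
      tile D false := by
    ext r
    refine ⟨fun hr => ?_, fun hr => ?_⟩
    · rw [mem_singleton_iff.mp hr]
      simpa using hv
    · simpa using eq_of_mem_tile_of_sub_mem hD hsq hr hv (by simp)
  refine discreteTopology_of_isOpen_singleton_zero ?_
  rw [hzero]
  exact (isOpen_tile D false).preimage (by fun_prop)

theorem isClosed_lattice (hD : 1 < D) (hsq : Squarefree D) :
    IsClosed (lattice D : Set (ℝ × ℝ)) := by
  have := discreteTopology_lattice hD hsq
  exact AddSubgroup.isClosed_of_discrete

theorem finite_setOf_mem_lattice_norm_le (hD : 1 < D) (hsq : Squarefree D) (C : ℝ) :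
    {v | v ∈ lattice D ∧ ‖v‖ ≤ C}.Finite := by
  have := discreteTopology_lattice hD hsq
  have hfinite := Metric.finite_isBounded_inter_isClosed DiscreteTopology.isDiscrete
    (Metric.isBounded_closedBall (x := 0) (r := C)) (isClosed_lattice hD hsq)
  exact hfinite.subset fun v hv => ⟨mem_closedBall_zero_iff.mpr hv.2, hv.1⟩

theorem t2Space_torus (hD : 1 < D) (hsq : Squarefree D) : T2Space (Torus D) := by
  have := isClosed_lattice hD hsq
  infer_instance

variable {ε : (O D)ˣ}

/-! ### The action of a unit -/

/-- The conjugate of a unit as a real number: the factor by which it scales stable coordinates. -/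
def unitS (D : ℕ) : (O D)ˣ →* ℝ :=
  ((RingHom.fst ℝ ℝ).comp ((embed D).comp (O D).subtype)).toMonoidHom.comp (Units.coeHom (O D))

/-- A unit as a real number: the factor by which it scales unstable coordinates. -/
def unitU (D : ℕ) : (O D)ˣ →* ℝ :=
  ((RingHom.snd ℝ ℝ).comp ((embed D).comp (O D).subtype)).toMonoidHom.comp (Units.coeHom (O D))

theorem phiV_apply (D : ℕ) (ε : (O D)ˣ) (v : ℝ × ℝ) :
    phiV D ε v = (unitS D ε * v.1, unitU D ε * v.2) := rfl

theorem unit_mem_lattice (D : ℕ) (ε : (O D)ˣ) : (unitS D ε, unitU D ε) ∈ lattice D :=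
  embed_mem_lattice (ε : O D)

theorem phiV_mul (D : ℕ) (ε ε' : (O D)ˣ) (v : ℝ × ℝ) :
    phiV D (ε * ε') v = phiV D ε (phiV D ε' v) := by
  simp only [phiV_apply, map_mul, mul_assoc]

theorem phiV_one (D : ℕ) (v : ℝ × ℝ) : phiV D 1 v = v := by
  simp only [phiV_apply, map_one, one_mul]

theorem phiV_inv_phiV (D : ℕ) (ε : (O D)ˣ) (v : ℝ × ℝ) : phiV D ε⁻¹ (phiV D ε v) = v := by
  rw [← phiV_mul, inv_mul_cancel, phiV_one]

theorem phiV_mem_lattice {v : ℝ × ℝ} (h : v ∈ lattice D) : phiV D ε v ∈ lattice D := by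
  rw [← map_phiV D ε]
  exact AddSubgroup.mem_map_of_mem _ h

theorem phiV_mem_lattice_iff {v : ℝ × ℝ} : phiV D ε v ∈ lattice D ↔ v ∈ lattice D :=
  ⟨fun h => phiV_inv_phiV D ε v ▸ phiV_mem_lattice h, phiV_mem_lattice⟩

theorem abs_norm_unit (D : ℕ) (ε : (O D)ˣ) :
    |QuadraticAlgebra.norm ((ε : O D) : K D)| = 1 := by
  obtain ⟨m, hm⟩ := exists_int_eq_norm (ε : O D).2
  obtain ⟨m', hm'⟩ := exists_int_eq_norm (ε⁻¹ : (O D)ˣ).val.2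
  have hmul : ((ε : O D) : K D) * ((ε⁻¹ : (O D)ˣ) : O D) = 1 :=
    congrArg Subtype.val ε.mul_inv
  have hmm : m * m' = 1 := by
    have : (m : ℚ) * m' = 1 := by rw [hm, hm', ← map_mul, hmul, map_one]
    exact_mod_cast this
  rw [← hm]
  exact_mod_cast Int.isUnit_iff_abs_eq.mp (IsUnit.of_mul_eq_one _ hmm)

theorem abs_unitS_mul_abs_unitU (D : ℕ) (ε : (O D)ˣ) : |unitS D ε| * |unitU D ε| = 1 := by
  rw [← abs_mul]
  refine (absNorm_embed D (ε : O D)).trans ?_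
  rw [← Rat.cast_abs, abs_norm_unit, Rat.cast_one]

theorem abs_unitS (hU : 1 < unitU D ε) : |unitS D ε| = (unitU D ε)⁻¹ := by
  refine eq_inv_of_mul_eq_one_left ?_
  rw [← abs_of_pos (zero_lt_one.trans hU)]
  exact abs_unitS_mul_abs_unitU D ε

theorem abs_unitS_lt_one (hU : 1 < unitU D ε) : |unitS D ε| < 1 :=
  abs_unitS hU ▸ inv_lt_one_of_one_lt₀ hU

theorem absNorm_phiV (D : ℕ) (ε : (O D)ˣ) (v : ℝ × ℝ) : absNorm (phiV D ε v) = absNorm v := by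
  simp only [absNorm, phiV_apply, abs_mul]
  rw [mul_mul_mul_comm, abs_unitS_mul_abs_unitU, one_mul]

theorem norm_phiV_le (hU : 1 < unitU D ε) (v : ℝ × ℝ) : ‖phiV D ε v‖ ≤ unitU D ε * ‖v‖ := by
  have hU0 : 0 < unitU D ε := zero_lt_one.trans hU
  rw [phiV_apply, norm_prod_le_iff, norm_mul, norm_mul, Real.norm_of_nonneg hU0.le]
  exact ⟨mul_le_mul ((abs_unitS_lt_one hU).le.trans hU.le) (norm_fst_le v) (norm_nonneg _) hU0.le,
    mul_le_mul_of_nonneg_left (norm_snd_le v) hU0.le⟩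

theorem proj_eq_proj_iff {v w : ℝ × ℝ} : proj D v = proj D w ↔ w - v ∈ lattice D := by
  rw [sub_eq_neg_add]
  exact QuotientAddGroup.eq

theorem phi_proj (D : ℕ) (ε : (O D)ˣ) (v : ℝ × ℝ) : phi D ε (proj D v) = proj D (phiV D ε v) :=
  rfl

theorem proj_surjective (D : ℕ) : Function.Surjective (proj D) := QuotientAddGroup.mk_surjective

theorem continuous_proj (D : ℕ) : Continuous (proj D) := QuotientAddGroup.continuous_mk

theorem phi_mul (D : ℕ) (ε ε' : (O D)ˣ) : phi D (ε * ε') = phi D ε * phi D ε' := by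
  ext P
  obtain ⟨v, rfl⟩ := proj_surjective D P
  rw [Equiv.Perm.mul_apply, phi_proj, phi_proj, phi_proj, phiV_mul]

theorem phi_zpow (D : ℕ) (ε : (O D)ˣ) (k : ℤ) : phi D ε ^ k = phi D (ε ^ k) :=
  (map_zpow (MonoidHom.mk' (phi D) (phi_mul D)) ε k).symm

theorem phi_zpow_proj (D : ℕ) (ε : (O D)ˣ) (k : ℤ) (v : ℝ × ℝ) :
    (phi D ε ^ k) (proj D v) = proj D (phiV D (ε ^ k) v) := by
  rw [phi_zpow, phi_proj]

theorem continuous_phiV (D : ℕ) (ε : (O D)ˣ) : Continuous (phiV D ε) :=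
  continuous_const.mul continuous_id

theorem continuous_phi (D : ℕ) (ε : (O D)ˣ) : Continuous (phi D ε) :=
  QuotientAddGroup.isOpenQuotientMap_mk.isQuotientMap.continuous_iff.mpr
    ((continuous_proj D).comp (continuous_phiV D ε))

theorem al_le_unitU (hD : 1 < D) (hsq : Squarefree D) (hU : 1 < unitU D ε)
    (hneg : unitS D ε < 0) : al D ≤ unitU D ε := by
  have ha := one_lt_al hD
  have hb := alBar_neg hD
  have hS := (abs_lt.mp (abs_unitS_lt_one hU)).1
  rcases mem_farRegion_of_mem_lattice hD hsq (unit_mem_lattice D ε) with h | h | h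
  · exact absurd (congrArg Prod.fst h) hneg.ne
  all_goals
    rcases h with ⟨h, -⟩ | ⟨-, h⟩ | h | h <;> simp only [Prod.fst_neg, Prod.snd_neg] at * <;>
      linarith

theorem stable_segment_mapsTo (hD : 1 < D) (hsq : Squarefree D) (hU : 1 < unitU D ε) :
    MapsTo (unitS D ε * ·) (Icc (-1) (-alBar D)) (Icc (-1) (-alBar D)) := by
  have hb := alBar_neg hD
  have ha := one_lt_al hD
  rintro x ⟨hx1, hx2⟩
  have hS := abs_unitS hU
  rcases lt_or_ge (unitS D ε) 0 with hneg | hpos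
  · have hle : -unitS D ε ≤ (al D)⁻¹ := by
      rw [← abs_of_neg hneg, hS]
      exact inv_anti₀ (by linarith) (al_le_unitU hD hsq hU hneg)
    have hbar : (al D)⁻¹ ≤ -alBar D :=
      (inv_le_iff_one_le_mul₀' (by linarith)).mpr (one_le_al_mul_neg_alBar hD)
    have hbar' : (al D)⁻¹ * -alBar D ≤ 1 :=
      inv_mul_le_one_of_le₀ (neg_alBar_le_al D) (by linarith)
    constructor <;> dsimp only <;> nlinarith
  · have hle : unitS D ε ≤ 1 := (abs_of_nonneg hpos ▸ abs_unitS_lt_one hU).le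
    constructor <;> dsimp only <;> nlinarith

/-! ### The Markov property -/

theorem inter_frontier_nonempty_of_isPreconnected {α : Type*} [TopologicalSpace α] {s t : Set α}
    (hs : IsPreconnected s) (hst : (s ∩ t).Nonempty) (hdiff : (s \ t).Nonempty) :
    (s ∩ frontier t).Nonempty := by
  by_contra hempty
  rw [not_nonempty_iff_eq_empty, ← disjoint_iff_inter_eq_empty, disjoint_left] at hempty
  have hcover : s ⊆ interior t ∪ (closure t)ᶜ := fun x hx =>
    or_iff_not_imp_left.mpr fun hxi hxc => hempty hx ⟨hxc, hxi⟩
  have hsub : s ⊆ interior t := by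
    obtain ⟨x, hx, hxt⟩ := hst
    exact hs.subset_left_of_subset_union isOpen_interior isClosed_closure.isOpen_compl
      (disjoint_compl_right_iff_subset.mpr interior_subset_closure) hcover
      ⟨x, hx, (hcover hx).resolve_right (not_not_intro (subset_closure hxt))⟩
  obtain ⟨x, hx, hxt⟩ := hdiff
  exact hxt (interior_subset (hsub hx))

theorem isPreconnected_tileS (D : ℕ) (b : Bool) : IsPreconnected (tileS D b) := by
  cases b <;> exact isPreconnected_Ioo

theorem isPreconnected_tileU (D : ℕ) (b : Bool) : IsPreconnected (tileU D b) := by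
  cases b <;> exact isPreconnected_Ioo

theorem tileS_subset_Icc (hD : 1 < D) (b : Bool) : tileS D b ⊆ Icc (-1) (-alBar D) := by
  have hb := alBar_neg hD
  cases b
  · exact Ioo_subset_Icc_self.trans (Icc_subset_Icc_left (by linarith))
  · exact Ioo_subset_Icc_self.trans (Icc_subset_Icc_right (by linarith))

theorem exists_sub_unstable_segment_mem_lattice (hD : 1 < D) {b : Bool} {p y : ℝ}
    (hp : p ∈ frontier (tileS D b)) (hy : y ∈ tileU D b) :
    ∃ z ∈ Icc 0 (1 + al D), (p, y) - (0, z) ∈ lattice D := by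
  have ha := one_lt_al hD
  cases b
  · rw [tileS, frontier_Ioo (neg_pos.mpr (alBar_neg hD))] at hp
    rcases hp with rfl | rfl
    · exact ⟨y, ⟨hy.1.le, by linarith [hy.2]⟩, by simp⟩
    · refine ⟨y + al D, ⟨by linarith [hy.1], by linarith [hy.2]⟩, ?_⟩
      simpa using neg_mem (alphaK_mem_lattice D)
  · rw [tileS, frontier_Ioo neg_one_lt_zero] at hp
    rcases hp with rfl | rfl
    · refine ⟨y + 1, ⟨by linarith [hy.1], by linarith [hy.2]⟩, ?_⟩
      simpa using neg_mem (one_mem_lattice D)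
    · exact ⟨y, ⟨hy.1.le, by linarith [hy.2]⟩, by simp⟩

theorem exists_sub_stable_segment_mem_lattice (hD : 1 < D) {b : Bool} {p s : ℝ}
    (hp : p ∈ frontier (tileU D b)) (hs : s ∈ tileS D b) :
    ∃ x ∈ Icc (-1) (-alBar D), (s, p) - (x, 0) ∈ lattice D := by
  have ha := zero_lt_one.trans (one_lt_al hD)
  have hb := alBar_neg hD
  cases b
  · rw [tileU, frontier_Ioo one_pos] at hp
    rcases hp with rfl | rfl
    · exact ⟨s, tileS_subset_Icc hD false hs, by simp⟩
    · refine ⟨s - 1, ⟨by linarith [hs.1], by linarith [hs.2]⟩, ?_⟩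
      simpa using one_mem_lattice D
  · rw [tileU, frontier_Ioo ha] at hp
    rcases hp with rfl | rfl
    · exact ⟨s, tileS_subset_Icc hD true hs, by simp⟩
    · refine ⟨s - alBar D, ⟨by linarith [hs.1], by linarith [hs.2]⟩, ?_⟩
      simpa using alphaK_mem_lattice D

/-- The part of the rectangle `b` that `φ` maps into the translate by `q` of the rectangle `b'`.
For `D ≠ 5` the letters of `P0` are the nonempty pieces. -/
def piece (D : ℕ) (ε : (O D)ˣ) (b b' : Bool) (q : ℝ × ℝ) : Set (ℝ × ℝ) :=
  {v ∈ tile D b | phiV D ε v - q ∈ tile D b'}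

-- Otherwise, by connectedness, some point of the rectangle `b` maps onto a side of `b'` that lies,
-- modulo the lattice, on the unstable segment. As `φ⁻¹` contracts this segment into itself, the
-- point itself then lies on the segment, which misses `b`.
theorem markov_stable (hD : 1 < D) (hsq : Squarefree D) (hU : 1 < unitU D ε) {b b' : Bool}
    {q : ℝ × ℝ} (hq : q ∈ lattice D) (hpiece : (piece D ε b b' q).Nonempty) {s : ℝ}
    (hs : s ∈ tileS D b) : unitS D ε * s - q.1 ∈ tileS D b' := by
  obtain ⟨v, hv, hw⟩ := hpiece
  by_contra hcon
  obtain ⟨_, ⟨x, hx, rfl⟩, hfr⟩ := inter_frontier_nonempty_of_isPreconnected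
    ((isPreconnected_tileS D b).image (fun x => unitS D ε * x - q.1) (by fun_prop))
    ⟨_, mem_image_of_mem _ hv.1, hw.1⟩ ⟨_, mem_image_of_mem _ hs, hcon⟩
  obtain ⟨z, ⟨hz0, hz1⟩, hz⟩ := exists_sub_unstable_segment_mem_lattice hD hfr hw.2
  have hU0 : 0 < unitU D ε := zero_lt_one.trans hU
  have hpre : phiV D ε ((x, v.2) - (0, z / unitU D ε)) =
      (unitS D ε * x - q.1, unitU D ε * v.2 - q.2) - (0, z) + q := by
    rw [phiV_apply]
    ext
    · simp
    · simp only [Prod.mk_sub_mk, sub_zero, Prod.snd_add, mul_sub, mul_div_cancel₀ z hU0.ne']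
      ring
  refine sub_unstable_segment_notMem_lattice hD hsq (v := (x, v.2)) ⟨hx, hv.2⟩
    (y := z / unitU D ε) ⟨by positivity, (div_le_self hz0 hU.le).trans hz1⟩ ?_
  rw [← phiV_mem_lattice_iff (ε := ε), hpre]
  exact add_mem hz hq

theorem markov_unstable (hD : 1 < D) (hsq : Squarefree D) (hU : 1 < unitU D ε) {b b' : Bool}
    {q : ℝ × ℝ} (hq : q ∈ lattice D) (hpiece : (piece D ε b b' q).Nonempty) {u : ℝ}
    (hu : u ∈ tileU D b') : (u + q.2) / unitU D ε ∈ tileU D b := by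
  obtain ⟨v, hv, hw⟩ := hpiece
  have hU0 : unitU D ε ≠ 0 := (zero_lt_one.trans hU).ne'
  have hpre : (unitU D ε * v.2 - q.2 + q.2) / unitU D ε = v.2 := by
    rw [sub_add_cancel, mul_div_cancel_left₀ _ hU0]
  by_contra hcon
  obtain ⟨_, ⟨y, hy, rfl⟩, hfr⟩ := inter_frontier_nonempty_of_isPreconnected
    ((isPreconnected_tileU D b').image (fun y => (y + q.2) / unitU D ε) (by fun_prop))
    ⟨v.2, ⟨_, hw.2, hpre⟩, hv.2⟩ ⟨_, mem_image_of_mem _ hu, hcon⟩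
  obtain ⟨x, hx, hmem⟩ := exists_sub_stable_segment_mem_lattice hD hfr hv.1
  have himage : (unitS D ε * v.1 - q.1, y) - (unitS D ε * x, 0) =
      phiV D ε ((v.1, (y + q.2) / unitU D ε) - (x, 0)) - q := by
    rw [phiV_apply]
    ext
    · simp only [Prod.mk_sub_mk, sub_zero, Prod.fst_sub]
      ring
    · simp [mul_div_cancel₀ _ hU0]
  refine sub_stable_segment_notMem_lattice hD hsq (v := (unitS D ε * v.1 - q.1, y)) ⟨hw.1, hy⟩
    (stable_segment_mapsTo hD hsq hU hx) ?_
  rw [himage]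
  exact sub_mem (phiV_mem_lattice hmem) hq

-- The unstable coordinate is chosen backwards in time, the stable one freely at the start.
theorem exists_orbit_through_stable (hD : 1 < D) (hsq : Squarefree D) (hU : 1 < unitU D ε)
    (N : ℕ) {b : ℕ → Bool} {q : ℕ → ℝ × ℝ} (hq : ∀ k, q k ∈ lattice D)
    (hpiece : ∀ k, (piece D ε (b k) (b (k + 1)) (q k)).Nonempty) :
    ∃ u ∈ tileU D (b 0), ∀ s ∈ tileS D (b 0), ∃ v : ℕ → ℝ × ℝ, v 0 = (s, u) ∧
      ∀ k < N, v k ∈ piece D ε (b k) (b (k + 1)) (q k) ∧ v (k + 1) = phiV D ε (v k) - q k := by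
  induction N generalizing b q with
  | zero =>
    obtain ⟨u, hu⟩ := tileU_nonempty hD (b 0)
    exact ⟨u, hu, fun s _ => ⟨fun _ => (s, u), rfl, fun k hk => absurd hk k.not_lt_zero⟩⟩
  | succ N ih =>
    obtain ⟨u, hu, hv⟩ := ih (fun k => hq (k + 1)) (fun k => hpiece (k + 1))
    have hu' := markov_unstable hD hsq hU (hq 0) (hpiece 0) hu
    refine ⟨_, hu', fun s hs => ?_⟩
    have hs' := markov_stable hD hsq hU (hq 0) (hpiece 0) hs
    obtain ⟨v, hv0, hv⟩ := hv _ hs'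
    have himage : phiV D ε (s, (u + (q 0).2) / unitU D ε) - q 0 = v 0 := by
      rw [hv0, phiV_apply, mul_div_cancel₀ _ (zero_lt_one.trans hU).ne']
      ext <;> simp
    refine ⟨fun k => k.casesOn (s, (u + (q 0).2) / unitU D ε) v, rfl, fun k hk => ?_⟩
    cases k with
    | zero => exact ⟨⟨⟨hs, hu'⟩, himage ▸ hv0 ▸ ⟨hs', hu⟩⟩, himage.symm⟩
    | succ k => exact hv k (Nat.lt_of_succ_lt_succ hk)

theorem exists_orbit (hD : 1 < D) (hsq : Squarefree D) (hU : 1 < unitU D ε) (N : ℕ)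
    {b : ℕ → Bool} {q : ℕ → ℝ × ℝ} (hq : ∀ k, q k ∈ lattice D)
    (hpiece : ∀ k, (piece D ε (b k) (b (k + 1)) (q k)).Nonempty) :
    ∃ v : ℕ → ℝ × ℝ, ∀ k < N,
      v k ∈ piece D ε (b k) (b (k + 1)) (q k) ∧ v (k + 1) = phiV D ε (v k) - q k := by
  obtain ⟨u, -, hv⟩ := exists_orbit_through_stable hD hsq hU N hq hpiece
  obtain ⟨s, hs⟩ := tileS_nonempty hD (b 0)
  obtain ⟨v, -, hv⟩ := hv s hs
  exact ⟨v, hv⟩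

/-! ### The generator -/

theorem phi_proj_eq_proj_iff {v w : ℝ × ℝ} :
    phi D ε (proj D v) = proj D w ↔ phiV D ε v - w ∈ lattice D := by
  rw [phi_proj, eq_comm, proj_eq_proj_iff]

theorem convex_piece (D : ℕ) (ε : (O D)ˣ) (b b' : Bool) (q : ℝ × ℝ) :
    Convex ℝ (piece D ε b b' q) := by
  intro x hx y hy r s hr hs hrs
  refine ⟨convex_tile D b hx.1 hy.1 hr hs hrs, ?_⟩
  have hcomb : phiV D ε (r • x + s • y) - q = r • (phiV D ε x - q) + s • (phiV D ε y - q) := by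
    rw [smul_sub, smul_sub, sub_add_sub_comm, ← add_smul, hrs, one_smul, map_add]
    simp only [phiV_apply, Prod.smul_mk, smul_eq_mul, Prod.smul_fst, Prod.smul_snd, mul_left_comm]
  exact hcomb ▸ convex_tile D b' hx.2 hy.2 hr hs hrs

theorem isOpen_piece (D : ℕ) (ε : (O D)ˣ) (b b' : Bool) (q : ℝ × ℝ) :
    IsOpen (piece D ε b b' q) :=
  (isOpen_tile D b).inter
    ((isOpen_tile D b').preimage ((continuous_phiV D ε).sub continuous_const))

theorem eq_of_mem_piece_of_mem_piece (hD : 1 < D) (hsq : Squarefree D) {b b' c c' : Bool}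
    {q r v : ℝ × ℝ} (hq : q ∈ lattice D) (hr : r ∈ lattice D) (hv : v ∈ piece D ε b b' q)
    (hv' : v ∈ piece D ε c c' r) : b' = c' ∧ q = r := by
  have heq := eq_of_mem_tile_of_sub_mem hD hsq hv.2 hv'.2
    (by rw [sub_sub_sub_cancel_left]; exact sub_mem hr hq)
  exact ⟨index_eq_of_mem_tile hv.2 (heq ▸ hv'.2), sub_right_inj.mp heq⟩

theorem overlap_tile_eq_iUnion (D : ℕ) (ε : (O D)ˣ) (b b' : Bool) :
    overlap D ε (tile D b) (tile D b') = ⋃ q ∈ lattice D, piece D ε b b' q := by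
  ext v
  simp only [mem_iUnion, exists_prop]
  constructor
  · rintro ⟨hv, w, hw, h⟩
    exact ⟨phiV D ε v - w, phi_proj_eq_proj_iff.mp h.symm, hv, by rwa [sub_sub_cancel]⟩
  · rintro ⟨q, hq, hv, hw⟩
    exact ⟨hv, _, hw, (phi_proj_eq_proj_iff.mpr (by rwa [sub_sub_cancel])).symm⟩

theorem connectedComponentIn_overlap (hD : 1 < D) (hsq : Squarefree D) {b b' : Bool}
    {q v : ℝ × ℝ} (hq : q ∈ lattice D) (hv : v ∈ piece D ε b b' q) :
    connectedComponentIn (overlap D ε (tile D b) (tile D b')) v = piece D ε b b' q := by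
  rw [overlap_tile_eq_iUnion]
  have hsub : piece D ε b b' q ⊆ ⋃ r ∈ lattice D, piece D ε b b' r :=
    subset_biUnion_of_mem (u := piece D ε b b') hq
  have hothers : IsOpen (⋃ r ∈ {r | r ∈ lattice D ∧ r ≠ q}, piece D ε b b' r) :=
    isOpen_biUnion fun r _ => isOpen_piece D ε b b' r
  refine Subset.antisymm ?_
    ((convex_piece D ε b b' q).isPreconnected.subset_connectedComponentIn hv hsub)
  refine isPreconnected_connectedComponentIn.subset_left_of_subset_union
    (isOpen_piece D ε b b' q) hothers ?_ ?_ ⟨v, mem_connectedComponentIn (hsub hv), hv⟩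
  · rw [disjoint_iUnion₂_right]
    rintro r ⟨hr, hrq⟩
    exact disjoint_left.mpr fun w hw hw' =>
      hrq (eq_of_mem_piece_of_mem_piece hD hsq hr hq hw' hw).2
  · refine (connectedComponentIn_subset _ _).trans (iUnion₂_subset fun r hr => ?_)
    by_cases hrq : r = q
    · exact hrq ▸ subset_union_left
    · exact (subset_biUnion_of_mem (u := piece D ε b b')
        (show r ∈ {r | r ∈ lattice D ∧ r ≠ q} from ⟨hr, hrq⟩)).trans subset_union_right

theorem exists_eq_piece (hD : 1 < D) (hsq : Squarefree D) (h5 : D ≠ 5) {C : Set (ℝ × ℝ)}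
    (hC : C ∈ P0 D ε) :
    ∃ b b' : Bool, ∃ q ∈ lattice D, (piece D ε b b' q).Nonempty ∧ C = piece D ε b b' q := by
  rw [P0, if_neg h5] at hC
  obtain ⟨A, hA, B, hB, v, hv, rfl⟩ := hC
  obtain ⟨b, rfl⟩ := mem_rectangles_iff.mp hA
  obtain ⟨b', rfl⟩ := mem_rectangles_iff.mp hB
  obtain ⟨q, hq, hvq⟩ := mem_iUnion₂.mp (overlap_tile_eq_iUnion D ε b b' ▸ hv)
  exact ⟨b, b', q, hq, ⟨v, hvq⟩, connectedComponentIn_overlap hD hsq hq hvq⟩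

theorem exists_eq_tile (h5 : D = 5) {C : Set (ℝ × ℝ)} (hC : C ∈ P0 D ε) :
    ∃ b : Bool, C = tile D b := by
  rw [P0, if_pos h5] at hC
  exact mem_rectangles_iff.mp hC

theorem exists_subset_tile (hD : 1 < D) (hsq : Squarefree D) {C : Set (ℝ × ℝ)}
    (hC : C ∈ P0 D ε) : ∃ b : Bool, C ⊆ tile D b := by
  by_cases h5 : D = 5
  · exact (exists_eq_tile h5 hC).imp fun b hb => hb.le
  · obtain ⟨b, b', q, -, -, rfl⟩ := exists_eq_piece hD hsq h5 hC
    exact ⟨b, sep_subset _ _⟩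

theorem norm_le_of_mem_piece (hD : 1 < D) (hU : 1 < unitU D ε) {b b' : Bool} {q v : ℝ × ℝ}
    (hv : v ∈ piece D ε b b' q) : ‖q‖ ≤ unitU D ε * al D + al D := by
  have hφ : ‖phiV D ε v‖ ≤ unitU D ε * al D := (norm_phiV_le hU v).trans <|
    mul_le_mul_of_nonneg_left (norm_le_of_mem_tile hD hv.1) (zero_lt_one.trans hU).le
  rw [← sub_sub_cancel (phiV D ε v) q]
  exact (norm_sub_le _ _).trans (add_le_add hφ (norm_le_of_mem_tile hD hv.2))

theorem finite_P0 (hD : 1 < D) (hsq : Squarefree D) (hU : 1 < unitU D ε) :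
    (P0 D ε).Finite := by
  by_cases h5 : D = 5
  · rw [P0, if_pos h5]
    exact toFinite _
  · have htranslations := finite_setOf_mem_lattice_norm_le hD hsq (unitU D ε * al D + al D)
    refine ((finite_univ.prod (finite_univ.prod htranslations)).image
      fun p : Bool × Bool × (ℝ × ℝ) => piece D ε p.1 p.2.1 p.2.2).subset fun C hC => ?_
    obtain ⟨b, b', q, hq, ⟨v, hv⟩, rfl⟩ := exists_eq_piece hD hsq h5 hC
    exact ⟨(b, b', q), ⟨mem_univ _, mem_univ _, hq, norm_le_of_mem_piece hD hU hv⟩, rfl⟩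

/-! ### The golden mean -/

theorem al_five : al 5 = Real.goldenRatio := by
  rw [al_eq, if_pos (by norm_num), Real.goldenRatio, Nat.cast_ofNat]

theorem alBar_five : alBar 5 = Real.goldenConj := by
  rw [alBar_eq, if_pos (by norm_num), Real.goldenConj, Nat.cast_ofNat]

theorem exists_unit_eq_alphaK_five : ∃ u : (O 5)ˣ, ((u : O 5) : K 5) = alphaK 5 := by
  have hmul : alphaK 5 * (alphaK 5 - 1) = 1 := by
    rw [alphaK, if_pos (by norm_num)]
    ext <;> norm_num [QuadraticAlgebra.re_one, QuadraticAlgebra.im_one]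
  have hα := isIntegral_alphaK 5
  obtain ⟨u, hu⟩ : IsUnit (⟨alphaK 5, hα⟩ : O 5) :=
    .of_mul_eq_one (⟨alphaK 5, hα⟩ - 1) (Subtype.ext hmul)
  exact ⟨u, congrArg Subtype.val hu⟩

theorem exists_zpow_five {ε : (O 5)ˣ} (hε : IsFundamentalUnit 5 ε) :
    ∃ k : ℤ, unitS 5 ε ^ k = Real.goldenConj ∧ unitU 5 ε ^ k = Real.goldenRatio := by
  obtain ⟨u, hu⟩ := exists_unit_eq_alphaK_five
  have huS : unitS 5 u = Real.goldenConj :=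
    (congrArg (fun a => realEmb 5 (star a)) hu).trans alBar_five
  have huU : unitU 5 u = Real.goldenRatio := (congrArg (realEmb 5) hu).trans al_five
  obtain ⟨k, rfl | rfl⟩ := hε.2 u
  · exact ⟨k, by rw [← huS, map_zpow], by rw [← huU, map_zpow]⟩
  · have hneg : unitU 5 (-ε ^ k) = -unitU 5 ε ^ k := by
      rw [← map_zpow]
      exact map_neg (realEmb 5) _
    have hpow : 0 < unitU 5 ε ^ k := zpow_pos (zero_lt_one.trans hε.1) k
    linarith [Real.goldenRatio_pos]

theorem unitS_five_neg {ε : (O 5)ˣ} (hε : IsFundamentalUnit 5 ε) : unitS 5 ε < 0 := by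
  obtain ⟨k, hS, -⟩ := exists_zpow_five hε
  by_contra! hpos
  exact (hS ▸ zpow_nonneg hpos k).not_gt Real.goldenConj_neg

theorem unitU_five {ε : (O 5)ˣ} (hε : IsFundamentalUnit 5 ε) :
    unitU 5 ε = Real.goldenRatio := by
  have hU : 1 < unitU 5 ε := hε.1
  obtain ⟨k, -, hk⟩ := exists_zpow_five hε
  have hk1 : 1 ≤ k := by
    by_contra! hk0
    exact (hk ▸ zpow_le_one_of_nonpos₀ hU.le (by lia : k ≤ 0)).not_gt Real.one_lt_goldenRatio
  refine le_antisymm ?_ ?_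
  · calc unitU 5 ε = unitU 5 ε ^ (1 : ℤ) := (zpow_one _).symm
      _ ≤ unitU 5 ε ^ k := zpow_le_zpow_right₀ hU.le hk1
      _ = Real.goldenRatio := hk
  · rw [← al_five]
    exact al_le_unitU (by norm_num) Nat.prime_five.squarefree hU (unitS_five_neg hε)

theorem unitS_five {ε : (O 5)ˣ} (hε : IsFundamentalUnit 5 ε) :
    unitS 5 ε = Real.goldenConj := by
  have h := abs_unitS (hε.1 : 1 < unitU 5 ε)
  rw [abs_of_neg (unitS_five_neg hε), unitU_five hε, Real.inv_goldenRatio] at h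
  exact neg_inj.mp h

theorem mem_tile_five_false {v : ℝ × ℝ} :
    v ∈ tile 5 false ↔ (0 < v.1 ∧ v.1 < -Real.goldenConj) ∧ 0 < v.2 ∧ v.2 < 1 := by
  rw [← alBar_five]
  rfl

theorem mem_tile_five_true {v : ℝ × ℝ} :
    v ∈ tile 5 true ↔ (-1 < v.1 ∧ v.1 < 0) ∧ 0 < v.2 ∧ v.2 < Real.goldenRatio := by
  rw [← al_five]
  rfl

theorem phiV_five {ε : (O 5)ˣ} (hε : IsFundamentalUnit 5 ε) (v : ℝ × ℝ) :
    phiV 5 ε v = (Real.goldenConj * v.1, Real.goldenRatio * v.2) := by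
  rw [phiV_apply, unitS_five hε, unitU_five hε]

theorem mem_piece_five_false_true {ε : (O 5)ˣ} (hε : IsFundamentalUnit 5 ε) {v : ℝ × ℝ}
    (hv : v ∈ tile 5 false) : v ∈ piece 5 ε false true 0 := by
  refine ⟨hv, ?_⟩
  obtain ⟨⟨hs, hs'⟩, hu, hu'⟩ := mem_tile_five_false.mp hv
  rw [sub_zero, phiV_five hε, mem_tile_five_true]
  have hψ := Real.goldenConj_neg
  have hφ := Real.goldenRatio_pos
  refine ⟨⟨?_, mul_neg_of_neg_of_pos hψ hs⟩, mul_pos hφ hu, mul_lt_of_lt_one_right hφ hu'⟩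
  nlinarith [Real.goldenConj_sq]

theorem mem_piece_five_true_false {ε : (O 5)ˣ} (hε : IsFundamentalUnit 5 ε) {v : ℝ × ℝ}
    (hv : v ∈ tile 5 true) (hlt : Real.goldenRatio * v.2 < 1) : v ∈ piece 5 ε true false 0 := by
  refine ⟨hv, ?_⟩
  obtain ⟨⟨hs, hs'⟩, hu, -⟩ := mem_tile_five_true.mp hv
  rw [sub_zero, phiV_five hε, mem_tile_five_false]
  have hψ := Real.goldenConj_neg
  exact ⟨⟨mul_pos_of_neg_of_neg hψ hs', by nlinarith⟩, mul_pos Real.goldenRatio_pos hu, hlt⟩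

theorem mem_piece_five_true_true {ε : (O 5)ˣ} (hε : IsFundamentalUnit 5 ε) {v : ℝ × ℝ}
    (hv : v ∈ tile 5 true) (hlt : 1 < Real.goldenRatio * v.2) :
    v ∈ piece 5 ε true true (1, 1) := by
  refine ⟨hv, ?_⟩
  obtain ⟨⟨hs, hs'⟩, -, hu'⟩ := mem_tile_five_true.mp hv
  rw [phiV_five hε, mem_tile_five_true]
  have hψ := Real.goldenConj_neg
  have hψ' := Real.neg_one_lt_goldenConj
  have hφ := Real.goldenRatio_pos
  refine ⟨⟨?_, ?_⟩, sub_pos.mpr hlt, ?_⟩ <;> simp only [Prod.fst_sub, Prod.snd_sub] <;>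
    nlinarith [Real.goldenRatio_sq]

theorem goldenRatio_mul_snd_ne_one {ε : (O 5)ˣ} (hε : IsFundamentalUnit 5 ε) {b' : Bool}
    {q v : ℝ × ℝ} (hq : q ∈ lattice 5) (hv : v ∈ piece 5 ε true b' q) :
    Real.goldenRatio * v.2 ≠ 1 := by
  intro h
  obtain ⟨⟨hs, hs'⟩, -⟩ := mem_tile_five_true.mp hv.1
  have hψ := Real.goldenConj_neg
  refine sub_stable_segment_notMem_lattice (by norm_num) Nat.prime_five.squarefree hv.2
    (x := Real.goldenConj * v.1 - 1) ⟨by nlinarith, ?_⟩ ?_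
  · rw [alBar_five]
    nlinarith
  · have hcorner : phiV 5 ε v - q - (Real.goldenConj * v.1 - 1, 0) = (1, 1) - q := by
      rw [phiV_five hε, h, sub_right_comm]
      congr 1
      ext <;> simp
    exact hcorner ▸ sub_mem (one_mem_lattice 5) hq

theorem eq_of_mem_piece_five {ε : (O 5)ˣ} (hε : IsFundamentalUnit 5 ε) {b b' : Bool}
    {q v : ℝ × ℝ} (hq : q ∈ lattice 5) (hv : v ∈ piece 5 ε b b' q) :
    q = if b && b' then (1, 1) else 0 := by
  have hunique {c : Bool} {r : ℝ × ℝ} (hr : r ∈ lattice 5) (h : v ∈ piece 5 ε b c r) :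
      b' = c ∧ q = r :=
    eq_of_mem_piece_of_mem_piece (by norm_num) Nat.prime_five.squarefree hq hr hv h
  cases b
  · exact (hunique (zero_mem _) (mem_piece_five_false_true hε hv.1)).2
  · rcases (goldenRatio_mul_snd_ne_one hε hq hv).lt_or_gt with h | h
    · obtain ⟨rfl, rfl⟩ := hunique (zero_mem _) (mem_piece_five_true_false hε hv.1 h)
      rfl
    · obtain ⟨rfl, rfl⟩ := hunique (one_mem_lattice 5) (mem_piece_five_true_true hε hv.1 h)
      rfl

/-! ### Cells and the coding map -/

theorem exists_translation_of_mem_P0 (hD : 1 < D) (hsq : Squarefree D)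
    (hfund : D = 5 → IsFundamentalUnit D ε) {A B : Set (ℝ × ℝ)} (hA : A ∈ P0 D ε)
    (hB : B ∈ P0 D ε) :
    ∃ q, ∀ x ∈ A, ∀ y ∈ B, phi D ε (proj D x) = proj D y → phiV D ε x - y = q := by
  by_cases h5 : D = 5
  · obtain ⟨b, rfl⟩ := exists_eq_tile h5 hA
    obtain ⟨b', rfl⟩ := exists_eq_tile h5 hB
    subst h5
    refine ⟨if b && b' then (1, 1) else 0, fun x hx y hy h => ?_⟩
    exact eq_of_mem_piece_five (hfund rfl) (phi_proj_eq_proj_iff.mp h)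
      ⟨hx, by rwa [sub_sub_cancel]⟩
  · obtain ⟨b, b', q, hq, -, rfl⟩ := exists_eq_piece hD hsq h5 hA
    obtain ⟨c, hc⟩ := exists_subset_tile hD hsq hB
    refine ⟨q, fun x hx y hy h => ?_⟩
    refine (eq_of_mem_piece_of_mem_piece hD hsq (phi_proj_eq_proj_iff.mp h) hq
      (⟨hx.1, ?_⟩ : x ∈ piece D ε b c (phiV D ε x - y)) hx).2
    rw [sub_sub_cancel]
    exact hc hy

theorem exists_mem_piece_of_mem_Sig {s : ℤ → Letter D ε} (hs : s ∈ Sig D ε) {i : ℤ} {b b' : Bool}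
    (hb : (s i : Set (ℝ × ℝ)) ⊆ tile D b) (hb' : (s (i + 1) : Set (ℝ × ℝ)) ⊆ tile D b') :
    ∃ q ∈ lattice D, ∃ v ∈ (s i : Set (ℝ × ℝ)), v ∈ piece D ε b b' q := by
  obtain ⟨_, ⟨v, hv, rfl⟩, w, hw, h⟩ := hs i
  exact ⟨_, phi_proj_eq_proj_iff.mp h.symm, v, hv, hb hv, by rw [sub_sub_cancel]; exact hb' hw⟩

theorem exists_itinerary (hD : 1 < D) (hsq : Squarefree D) {s : ℤ → Letter D ε}
    (hs : s ∈ Sig D ε) :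
    ∃ (b : ℤ → Bool) (q : ℤ → ℝ × ℝ), ∀ i, q i ∈ lattice D ∧
      (piece D ε (b i) (b (i + 1)) (q i)).Nonempty ∧
        piece D ε (b i) (b (i + 1)) (q i) ⊆ s i := by
  choose b hb using fun i => exists_subset_tile hD hsq (s i).2
  choose q hq v hv hvq using fun i => exists_mem_piece_of_mem_Sig hs (hb i) (hb (i + 1))
  refine ⟨b, q, fun i => ⟨hq i, ⟨v i, hvq i⟩, ?_⟩⟩
  by_cases h5 : D = 5
  · obtain ⟨c, hc⟩ := exists_eq_tile h5 (s i).2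
    have hbc : b i = c := index_eq_of_mem_tile (hb i (hv i)) (hc ▸ hv i)
    rw [hc, hbc]
    exact sep_subset _ _
  · obtain ⟨c, c', r, hr, -, hc⟩ := exists_eq_piece hD hsq h5 (s i).2
    have hvr : v i ∈ piece D ε c c' r := hc ▸ hv i
    have hbc : b i = c := index_eq_of_mem_tile (hb i (hv i)) hvr.1
    obtain ⟨hbc', hqr⟩ := eq_of_mem_piece_of_mem_piece hD hsq (hq i) hr (hvq i) hvr
    rw [hc, hbc, hbc', hqr]

/-- The word of the string `s` on the window `[-n, n]`. -/
def word (s : ℤ → Letter D ε) (n : ℕ) : Word D ε n := fun i => s i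

/-- The string `s` translated by `k`, so that its letter at `k` moves to `0`. -/
def shift {α : Type*} (k : ℤ) (s : ℤ → α) : ℤ → α := fun i => s (k + i)

theorem shift_mem_Sig {s : ℤ → Letter D ε} (hs : s ∈ Sig D ε) (k : ℤ) :
    shift k s ∈ Sig D ε := by
  intro i
  have := hs (k + i)
  rwa [add_assoc] at this

theorem phi_zpow_proj_orbit {N : ℕ} {v q : ℕ → ℝ × ℝ} (hq : ∀ k, q k ∈ lattice D)
    (hv : ∀ k < N, v (k + 1) = phiV D ε (v k) - q k) {k : ℕ} (hk : k ≤ N) :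
    (phi D ε ^ (k : ℤ)) (proj D (v 0)) = proj D (v k) := by
  induction k with
  | zero => rfl
  | succ k ih =>
    rw [Nat.cast_succ, add_comm, zpow_add, zpow_one, Equiv.Perm.mul_apply, ih (by lia),
      phi_proj_eq_proj_iff, hv k (by lia), sub_sub_cancel]
    exact hq k

theorem cell_nonempty (hD : 1 < D) (hsq : Squarefree D) (hU : 1 < unitU D ε)
    {s : ℤ → Letter D ε} (hs : s ∈ Sig D ε) (n : ℕ) : (cell D ε n (word s n)).Nonempty := by
  obtain ⟨b, q, hbq⟩ := exists_itinerary hD hsq hs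
  have hsucc (k : ℕ) : -(n : ℤ) + (k + 1 : ℕ) = -(n : ℤ) + k + 1 := by push_cast; ring
  obtain ⟨v, hv⟩ := exists_orbit hD hsq hU (2 * n + 1) (b := fun k => b (-(n : ℤ) + k))
    (q := fun k => q (-(n : ℤ) + k)) (fun k => (hbq _).1)
    (fun k => by simp only [hsucc]; exact (hbq _).2.1)
  have hletter {k : ℕ} (hk : k < 2 * n + 1) : v k ∈ (s (-(n : ℤ) + k) : Set (ℝ × ℝ)) :=
    (hbq _).2.2 (by simpa only [hsucc] using (hv k hk).1)
  have horbit {k : ℕ} (hk : k ≤ 2 * n + 1) :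
      (phi D ε ^ (k : ℤ)) (proj D (v 0)) = proj D (v k) :=
    phi_zpow_proj_orbit (fun k => (hbq _).1) (fun k hk => (hv k hk).2) hk
  have hcenter : v n ∈ (s 0 : Set (ℝ × ℝ)) := by
    simpa only [neg_add_cancel] using hletter (k := n) (by lia)
  refine ⟨v n, hcenter, ?_⟩
  rintro ⟨i, hi⟩
  obtain ⟨k, rfl⟩ : ∃ k : ℕ, i = -(n : ℤ) + k := ⟨(i + n).toNat, by have := hi.1; lia⟩
  have hk : k < 2 * n + 1 := by have := hi.2; lia
  refine ⟨v k, hletter hk, ?_⟩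
  calc proj D (v k) = (phi D ε ^ (-(n : ℤ) + k + n)) (proj D (v 0)) := by
        rw [neg_add_cancel_comm, horbit hk.le]
    _ = (phi D ε ^ (-(n : ℤ) + k)) (proj D (v n)) := by
        rw [zpow_add, Equiv.Perm.mul_apply, horbit (by lia)]

theorem norm_le_of_mem_letter (hD : 1 < D) (hsq : Squarefree D) (A : Letter D ε) {v : ℝ × ℝ}
    (hv : v ∈ (A : Set (ℝ × ℝ))) : ‖v‖ ≤ al D := by
  obtain ⟨b, hb⟩ := exists_subset_tile hD hsq A.2
  exact norm_le_of_mem_tile hD (hb hv)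

/-- `Z` runs through planar lifts, taken in the letters of `w`, of the orbit of the torus point
below `Z 0`. -/
def LiftsAlong {n : ℕ} (w : Word D ε n) (Z : ℤ → ℝ × ℝ) : Prop :=
  ∀ i (hi : i ∈ Icc (-(n : ℤ)) n), Z i ∈ (w ⟨i, hi⟩ : Set (ℝ × ℝ)) ∧
    (phi D ε ^ i) (proj D (Z 0)) = proj D (Z i)

theorem exists_liftsAlong {n : ℕ} {w : Word D ε n} {z : ℝ × ℝ} (hz : z ∈ cell D ε n w) :
    ∃ Z, LiftsAlong w Z ∧ Z 0 = z := by
  choose Z hZ hproj using hz.2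
  let Z' : ℤ → ℝ × ℝ :=
    Function.update (fun i => if hi : i ∈ Icc (-(n : ℤ)) n then Z ⟨i, hi⟩ else z) 0 z
  have hZ'0 : Z' 0 = z := Function.update_self ..
  refine ⟨Z', fun i hi => ?_, hZ'0⟩
  rw [hZ'0]
  rcases eq_or_ne i 0 with rfl | hi0
  · rw [hZ'0]
    exact ⟨hz.1, rfl⟩
  · have hZ'i : Z' i = Z ⟨i, hi⟩ := (Function.update_of_ne hi0 ..).trans (dif_pos hi)
    rw [hZ'i]
    exact ⟨hZ _, (hproj ⟨i, hi⟩).symm⟩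

theorem LiftsAlong.phi_proj {n : ℕ} {w : Word D ε n} {Z : ℤ → ℝ × ℝ} (hZ : LiftsAlong w Z)
    {i : ℤ} (hi : i ∈ Icc (-(n : ℤ)) n) (hi' : i + 1 ∈ Icc (-(n : ℤ)) n) :
    phi D ε (proj D (Z i)) = proj D (Z (i + 1)) := by
  rw [← (hZ i hi).2, ← (hZ _ hi').2, ← Equiv.Perm.mul_apply, add_comm, zpow_add, zpow_one]

theorem LiftsAlong.sub_add_natCast (hD : 1 < D) (hsq : Squarefree D)
    (hfund : D = 5 → IsFundamentalUnit D ε) {n : ℕ} {w : Word D ε n} {X Y : ℤ → ℝ × ℝ}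
    (hX : LiftsAlong w X) (hY : LiftsAlong w Y) {i : ℤ} (hi : -(n : ℤ) ≤ i) {k : ℕ}
    (hk : i + k ≤ n) : X (i + k) - Y (i + k) = phiV D (ε ^ k) (X i - Y i) := by
  induction k with
  | zero => rw [Nat.cast_zero, add_zero, pow_zero, phiV_one]
  | succ k ih =>
    push_cast at hk ⊢
    have hik : i + k ∈ Icc (-(n : ℤ)) n := ⟨by lia, by lia⟩
    have hik' : i + k + 1 ∈ Icc (-(n : ℤ)) n := ⟨by lia, by lia⟩
    obtain ⟨q, hq⟩ :=
      exists_translation_of_mem_P0 hD hsq hfund (w ⟨_, hik⟩).2 (w ⟨_, hik'⟩).2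
    have hqX := hq _ (hX _ hik).1 _ (hX _ hik').1 (hX.phi_proj hik hik')
    have hqY := hq _ (hY _ hik).1 _ (hY _ hik').1 (hY.phi_proj hik hik')
    rw [pow_succ', phiV_mul, ← ih (by lia), map_sub, ← add_assoc]
    exact (sub_eq_sub_iff_sub_eq_sub.mp (hqX.trans hqY.symm)).symm

theorem LiftsAlong.norm_sub_le (hD : 1 < D) (hsq : Squarefree D) {n : ℕ} {w : Word D ε n}
    {X Y : ℤ → ℝ × ℝ} (hX : LiftsAlong w X) (hY : LiftsAlong w Y) {i : ℤ}
    (hi : i ∈ Icc (-(n : ℤ)) n) : ‖X i - Y i‖ ≤ 2 * al D := by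
  rw [two_mul]
  exact norm_sub_le_of_le (norm_le_of_mem_letter hD hsq _ (hX i hi).1)
    (norm_le_of_mem_letter hD hsq _ (hY i hi).1)

theorem norm_le_of_norm_phiV_pow_le (hU : 1 < unitU D ε) {n : ℕ} {C : ℝ} {v : ℝ × ℝ}
    (hpast : ∃ v', phiV D (ε ^ n) v' = v ∧ ‖v'‖ ≤ C) (hfuture : ‖phiV D (ε ^ n) v‖ ≤ C) :
    ‖v‖ ≤ C * (unitU D ε)⁻¹ ^ n := by
  have hU0 : 0 < unitU D ε ^ n := pow_pos (zero_lt_one.trans hU) n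
  rw [norm_prod_le_iff]
  constructor
  · obtain ⟨v', rfl, hv'⟩ := hpast
    rw [phiV_apply, norm_mul, map_pow, norm_pow, Real.norm_eq_abs, abs_unitS hU, mul_comm]
    exact mul_le_mul_of_nonneg_right ((norm_fst_le v').trans hv')
      (inv_pow (unitU D ε) n ▸ (inv_pos.mpr hU0).le)
  · have hsnd := (norm_snd_le _).trans hfuture
    rw [phiV_apply, norm_mul, map_pow, Real.norm_of_nonneg hU0.le] at hsnd
    rwa [inv_pow, ← div_eq_mul_inv, le_div_iff₀ hU0, mul_comm]

theorem dist_le_of_mem_cell (hD : 1 < D) (hsq : Squarefree D) (hU : 1 < unitU D ε)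
    (hfund : D = 5 → IsFundamentalUnit D ε) {n : ℕ} {w : Word D ε n} {x y : ℝ × ℝ}
    (hx : x ∈ cell D ε n w) (hy : y ∈ cell D ε n w) :
    dist x y ≤ 2 * al D * (unitU D ε)⁻¹ ^ n := by
  obtain ⟨X, hX, rfl⟩ := exists_liftsAlong hx
  obtain ⟨Y, hY, rfl⟩ := exists_liftsAlong hy
  have hpast := hX.sub_add_natCast hD hsq hfund hY (le_refl (-(n : ℤ))) (k := n) (by lia)
  have hfuture := hX.sub_add_natCast hD hsq hfund hY (i := 0) (by lia) (k := n) (by lia)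
  rw [neg_add_cancel] at hpast
  rw [zero_add] at hfuture
  rw [dist_eq_norm]
  refine norm_le_of_norm_phiV_pow_le hU
    ⟨_, hpast.symm, hX.norm_sub_le hD hsq hY ⟨le_rfl, by lia⟩⟩ ?_
  rw [← hfuture]
  exact hX.norm_sub_le hD hsq hY ⟨by lia, le_rfl⟩

theorem dist_le_of_mem_closure_cell (hD : 1 < D) (hsq : Squarefree D) (hU : 1 < unitU D ε)
    (hfund : D = 5 → IsFundamentalUnit D ε) {n : ℕ} {w : Word D ε n} {x y : ℝ × ℝ}
    (hx : x ∈ closure (cell D ε n w)) (hy : y ∈ closure (cell D ε n w)) :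
    dist x y ≤ 2 * al D * (unitU D ε)⁻¹ ^ n := by
  have hpair : (x, y) ∈ closure (cell D ε n w ×ˢ cell D ε n w) := by
    rw [closure_prod_eq]
    exact ⟨hx, hy⟩
  exact closure_minimal (t := {p : (ℝ × ℝ) × (ℝ × ℝ) | dist p.1 p.2 ≤ _})
    (fun p hp => dist_le_of_mem_cell hD hsq hU hfund hp.1 hp.2)
    (isClosed_le continuous_dist continuous_const) hpair

theorem norm_le_of_mem_closure_cell (hD : 1 < D) (hsq : Squarefree D) {n : ℕ} {w : Word D ε n}
    {x : ℝ × ℝ} (hx : x ∈ closure (cell D ε n w)) : ‖x‖ ≤ al D :=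
  closure_minimal (fun _ hv => norm_le_of_mem_letter hD hsq _ hv.1)
    (isClosed_le continuous_norm continuous_const) hx

theorem isCompact_closure_cell (hD : 1 < D) (hsq : Squarefree D) {n : ℕ} (w : Word D ε n) :
    IsCompact (closure (cell D ε n w)) :=
  (isCompact_closedBall (0 : ℝ × ℝ) (al D)).of_isClosed_subset isClosed_closure fun _ hx =>
    mem_closedBall_zero_iff.mpr (norm_le_of_mem_closure_cell hD hsq hx)

theorem cell_word_succ_subset (s : ℤ → Letter D ε) (n : ℕ) :
    cell D ε (n + 1) (word s (n + 1)) ⊆ cell D ε n (word s n) :=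
  fun _ ⟨h0, h⟩ => ⟨h0, fun i => h ⟨i, by have := i.2.1; lia, by have := i.2.2; lia⟩⟩

theorem biInter_eq_proj_image_cell (s : ℤ → Letter D ε) (n : ℕ) :
    ⋂ i ∈ Icc (-(n : ℤ)) n, {P | (phi D ε ^ i) P ∈ tset D ε (s i)} =
      proj D '' cell D ε n (word s n) := by
  refine Subset.antisymm (fun P hP => ?_) ?_
  · rw [mem_iInter₂] at hP
    obtain ⟨v, hv, rfl⟩ := hP 0 ⟨by lia, by lia⟩
    exact ⟨v, ⟨hv, fun i => hP i i.2⟩, rfl⟩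
  · rintro _ ⟨v, ⟨-, hv⟩, rfl⟩
    exact mem_iInter₂.mpr fun i hi => hv ⟨i, hi⟩

theorem tendsto_const_mul_inv_unitU_pow (hU : 1 < unitU D ε) (c : ℝ) :
    Filter.Tendsto (fun n : ℕ => c * (unitU D ε)⁻¹ ^ n) Filter.atTop (𝓝 0) := by
  rw [← mul_zero c]
  exact (tendsto_pow_atTop_nhds_zero_of_lt_one (inv_nonneg.mpr (zero_lt_one.trans hU).le)
    (inv_lt_one_of_one_lt₀ hU)).const_mul c

theorem codingSet_eq_iInter (hD : 1 < D) (hsq : Squarefree D) (s : ℤ → Letter D ε) :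
    codingSet D ε s = ⋂ n : ℕ, proj D '' closure (cell D ε n (word s n)) := by
  have := t2Space_torus hD hsq
  refine iInter_congr fun n => ?_
  rw [biInter_eq_proj_image_cell]
  exact (image_closure_of_isCompact (isCompact_closure_cell hD hsq _)
    (continuous_proj D).continuousOn).symm

theorem exists_mem_closure_cell (hD : 1 < D) (hsq : Squarefree D) (hU : 1 < unitU D ε)
    {s : ℤ → Letter D ε} (hs : s ∈ Sig D ε) : ∃ x, ∀ n, x ∈ closure (cell D ε n (word s n)) := by
  obtain ⟨x, hx⟩ := IsCompact.nonempty_iInter_of_sequence_nonempty_isCompact_isClosed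
    (fun n => closure (cell D ε n (word s n))) (fun n => closure_mono (cell_word_succ_subset s n))
    (fun n => (cell_nonempty hD hsq hU hs n).closure) (isCompact_closure_cell hD hsq _)
    (fun n => isClosed_closure)
  exact ⟨x, mem_iInter.mp hx⟩

theorem codingSet_eq_singleton (hD : 1 < D) (hsq : Squarefree D) (hU : 1 < unitU D ε)
    (hfund : D = 5 → IsFundamentalUnit D ε) {s : ℤ → Letter D ε} {x : ℝ × ℝ}
    (hx : ∀ n, x ∈ closure (cell D ε n (word s n))) : codingSet D ε s = {proj D x} := by
  have := t2Space_torus hD hsq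
  rw [codingSet_eq_iInter hD hsq]
  refine Subset.antisymm (fun P hP => ?_) ?_
  · choose y hy hyP using mem_iInter.mp hP
    have hyx : Filter.Tendsto y Filter.atTop (𝓝 x) := tendsto_iff_dist_tendsto_zero.mpr <|
      squeeze_zero (fun n => dist_nonneg)
        (fun n => dist_le_of_mem_closure_cell hD hsq hU hfund (hy n) (hx n))
        (tendsto_const_mul_inv_unitU_pow hU _)
    have hPx := ((continuous_proj D).tendsto x).comp hyx
    rw [(funext hyP : proj D ∘ y = fun _ => P)] at hPx
    exact tendsto_nhds_unique tendsto_const_nhds hPx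
  · rintro _ rfl
    exact mem_iInter.mpr fun n => mem_image_of_mem _ (hx n)

theorem exists_lift_piMap (hD : 1 < D) (hsq : Squarefree D) (hU : 1 < unitU D ε)
    (hfund : D = 5 → IsFundamentalUnit D ε) {s : ℤ → Letter D ε} (hs : s ∈ Sig D ε) :
    ∃ x, piMap D ε s = proj D x ∧ ∀ n, x ∈ closure (cell D ε n (word s n)) := by
  obtain ⟨x, hx⟩ := exists_mem_closure_cell hD hsq hU hs
  have hcode := codingSet_eq_singleton hD hsq hU hfund hx
  have hpi : codingSet D ε s = {piMap D ε s} :=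
    Classical.epsilon_spec (p := fun P => codingSet D ε s = {P}) ⟨_, hcode⟩
  exact ⟨x, singleton_injective (hpi.symm.trans hcode), hx⟩

theorem codingSet_eq_piMap (hD : 1 < D) (hsq : Squarefree D) (hU : 1 < unitU D ε)
    (hfund : D = 5 → IsFundamentalUnit D ε) {s : ℤ → Letter D ε} (hs : s ∈ Sig D ε) :
    codingSet D ε s = {piMap D ε s} := by
  obtain ⟨x, hpi, hx⟩ := exists_lift_piMap hD hsq hU hfund hs
  rw [hpi, codingSet_eq_singleton hD hsq hU hfund hx]

theorem phi_zpow_mem_codingSet_shift {s : ℤ → Letter D ε} {P : Torus D}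
    (hP : P ∈ codingSet D ε s) (k : ℤ) : (phi D ε ^ k) P ∈ codingSet D ε (shift k s) := by
  rw [codingSet, mem_iInter] at hP ⊢
  intro n
  rw [phi_zpow]
  refine map_mem_closure (continuous_phi D (ε ^ k)) (hP (n + k.natAbs)) fun Q hQ => ?_
  rw [mem_iInter₂] at hQ ⊢
  rintro i ⟨hi, hi'⟩
  have hwindow := hQ (k + i) ⟨by lia, by lia⟩
  have hcomp : (phi D ε ^ (k + i)) Q = (phi D ε ^ i) (phi D (ε ^ k) Q) := by
    rw [add_comm, zpow_add, Equiv.Perm.mul_apply, phi_zpow D ε k]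
  rw [mem_ofPred_eq, hcomp] at hwindow
  exact hwindow

theorem piMap_shift (hD : 1 < D) (hsq : Squarefree D) (hU : 1 < unitU D ε)
    (hfund : D = 5 → IsFundamentalUnit D ε) {s : ℤ → Letter D ε} (hs : s ∈ Sig D ε) (k : ℤ) :
    piMap D ε (shift k s) = (phi D ε ^ k) (piMap D ε s) := by
  have hP : piMap D ε s ∈ codingSet D ε s :=
    codingSet_eq_piMap hD hsq hU hfund hs ▸ mem_singleton _
  have hshift := phi_zpow_mem_codingSet_shift hP k
  rw [codingSet_eq_piMap hD hsq hU hfund (shift_mem_Sig hs k)] at hshift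
  exact hshift.symm

theorem euclMin_proj_lt_iff {v : ℝ × ℝ} {t : ℝ} :
    euclMin D (proj D v) < t ↔ ∃ q ∈ lattice D, absNorm (v - q) < t := by
  have hbdd : BddBelow (range fun q : lattice D => absNorm (v - q)) :=
    ⟨0, by rintro _ ⟨q, rfl⟩; exact abs_nonneg _⟩
  refine (ciInf_lt_iff hbdd).trans ?_
  rw [Subtype.exists]
  simp only [exists_prop]

theorem euclMin_phi (D : ℕ) (ε : (O D)ˣ) (P : Torus D) : euclMin D (phi D ε P) = euclMin D P := by
  have hle (ε : (O D)ˣ) (P : Torus D) : euclMin D (phi D ε P) ≤ euclMin D P := by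
    obtain ⟨v, rfl⟩ := proj_surjective D P
    refine le_of_forall_gt fun t ht => ?_
    obtain ⟨q, hq, hlt⟩ := euclMin_proj_lt_iff.mp ht
    rw [phi_proj, euclMin_proj_lt_iff]
    exact ⟨_, phiV_mem_lattice hq, by rwa [← map_sub, absNorm_phiV]⟩
  refine (hle ε P).antisymm ?_
  have hinv : phi D ε⁻¹ (phi D ε P) = P := by
    obtain ⟨v, rfl⟩ := proj_surjective D P
    rw [phi_proj, phi_proj, phiV_inv_phiV]
  simpa only [hinv] using hle ε⁻¹ (phi D ε P)

theorem shift_mem_piInv_X (hD : 1 < D) (hsq : Squarefree D) (hU : 1 < unitU D ε)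
    (hfund : D = 5 → IsFundamentalUnit D ε) {t : ℝ} {s : ℤ → Letter D ε}
    (hs : s ∈ piInv D ε (X D t)) (k : ℤ) : shift k s ∈ piInv D ε (X D t) := by
  refine ⟨shift_mem_Sig hs.1 k, ?_⟩
  rw [piMap_shift hD hsq hU hfund hs.1, phi_zpow]
  exact hs.2.trans_eq (euclMin_phi D _ _).symm

theorem absNorm_le_sq (v : ℝ × ℝ) : absNorm v ≤ ‖v‖ ^ 2 := by
  rw [absNorm, abs_mul, pow_two]
  exact mul_le_mul (norm_fst_le v) (norm_snd_le v) (abs_nonneg _) (norm_nonneg _)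

theorem absNorm_add_le (v w : ℝ × ℝ) :
    absNorm (v + w) ≤ absNorm v + ‖w‖ * (2 * ‖v‖ + ‖w‖) := by
  have hexpand : (v + w).1 * (v + w).2 = v.1 * v.2 + (w.1 * v.2 + v.1 * w.2 + w.1 * w.2) := by
    rw [Prod.fst_add, Prod.snd_add]
    ring
  have hbound (a b : ℝ × ℝ) : |a.1 * b.2| ≤ ‖a‖ * ‖b‖ := by
    rw [abs_mul]
    exact mul_le_mul (norm_fst_le a) (norm_snd_le b) (abs_nonneg _) (norm_nonneg _)
  calc absNorm (v + w) ≤ |v.1 * v.2| + (|w.1 * v.2| + |v.1 * w.2| + |w.1 * w.2|) := by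
        rw [absNorm, hexpand]
        exact (abs_add_le _ _).trans (add_le_add_right (abs_add_three _ _ _) _)
    _ ≤ absNorm v + (‖w‖ * ‖v‖ + ‖v‖ * ‖w‖ + ‖w‖ * ‖w‖) :=
        add_le_add_right (add_le_add_three (hbound w v) (hbound v w) (hbound w w)) _
    _ = absNorm v + ‖w‖ * (2 * ‖v‖ + ‖w‖) := by ring

theorem exists_zpow_mul_mem_Ioc {a x : ℝ} (ha : 1 < a) (hx : 0 < x) :
    ∃ k : ℤ, a ^ k * x ∈ Ioc 1 a := by
  have ha0 : 0 < a := zero_lt_one.trans ha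
  obtain ⟨m, hm, hm'⟩ := exists_mem_Ioc_zpow hx ha
  have hpos : 0 < a ^ m := zpow_pos ha0 m
  refine ⟨-m, ?_, ?_⟩ <;> rw [zpow_neg, inv_mul_eq_div]
  · rwa [one_lt_div hpos]
  · rwa [div_le_iff₀ hpos, ← zpow_one_add₀ ha0.ne', add_comm]

theorem abs_snd_phiV_zpow (hU : 1 < unitU D ε) (k : ℤ) (v : ℝ × ℝ) :
    |(phiV D (ε ^ k) v).2| = unitU D ε ^ k * |v.2| := by
  rw [phiV_apply, abs_mul, map_zpow, abs_of_pos (zpow_pos (zero_lt_one.trans hU) k)]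

theorem abs_fst_phiV_zpow (hU : 1 < unitU D ε) (k : ℤ) (v : ℝ × ℝ) :
    |(phiV D (ε ^ k) v).1| = unitU D ε ^ (-k) * |v.1| := by
  rw [phiV_apply, abs_mul, map_zpow, abs_zpow, abs_unitS hU, inv_zpow']

theorem exists_norm_phiV_zpow_le (hU : 1 < unitU D ε) (v : ℝ × ℝ) :
    ∃ k : ℤ, ‖phiV D (ε ^ k) v‖ ≤ unitU D ε + absNorm v := by
  have hN : 0 ≤ absNorm v := abs_nonneg _
  simp only [norm_prod_le_iff, Real.norm_eq_abs]
  by_cases hu : v.2 = 0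
  · by_cases hs : v.1 = 0
    · obtain rfl : v = 0 := Prod.ext hs hu
      refine ⟨0, ?_⟩
      simp only [map_zero, Prod.fst_zero, Prod.snd_zero, abs_zero, and_self]
      linarith
    · obtain ⟨k, -, hk⟩ := exists_zpow_mul_mem_Ioc hU (abs_pos.mpr hs)
      refine ⟨-k, ?_, ?_⟩
      · rw [abs_fst_phiV_zpow hU, neg_neg]
        linarith
      · rw [abs_snd_phiV_zpow hU, hu, abs_zero, mul_zero]
        linarith
  · obtain ⟨k, hk, hk'⟩ := exists_zpow_mul_mem_Ioc hU (abs_pos.mpr hu)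
    rw [← abs_snd_phiV_zpow hU] at hk hk'
    refine ⟨k, ?_, by linarith⟩
    calc |(phiV D (ε ^ k) v).1| ≤ |(phiV D (ε ^ k) v).1| * |(phiV D (ε ^ k) v).2| :=
          le_mul_of_one_le_right (abs_nonneg _) hk.le
      _ = absNorm v := by rw [← abs_mul]; exact absNorm_phiV D _ v
      _ ≤ unitU D ε + absNorm v := by linarith

/-! ### Forbidden words -/

theorem IsSFT.inter {α : Type*} {Y Z : Set (ℤ → α)} (hY : IsSFT Y) (hZ : IsSFT Z) :
    IsSFT (Y ∩ Z) := by
  obtain ⟨hfin, F, hF, rfl⟩ := hY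
  obtain ⟨-, G, hG, rfl⟩ := hZ
  refine ⟨hfin, F ∪ G, hF.union hG, ?_⟩
  ext s
  exact forall₂_or_left.symm

theorem isSFT_setOf_forall_window {α : Type*} [Finite α] {N : ℕ} (p : (Fin N → α) → Prop) :
    IsSFT {s : ℤ → α | ∀ k : ℤ, p fun j => s (k + (j : ℕ))} := by
  refine ⟨inferInstance, List.ofFn '' {w | ¬ p w}, (toFinite _).image _, Set.ext fun s => ?_⟩
  constructor
  · rintro hs _ ⟨w, hw, rfl⟩ ⟨k, hk⟩
    refine hw ?_
    convert hs k with j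
    simpa using (hk (j.cast List.length_ofFn.symm)).symm
  · intro hs k
    by_contra hp
    exact hs _ ⟨_, hp, rfl⟩ ⟨k, fun j => by simp⟩

theorem isSFT_Sig [Finite (Letter D ε)] : IsSFT (Sig D ε) := by
  convert isSFT_setOf_forall_window fun w : Fin 2 → Letter D ε =>
    (tset D ε (w 0) ∩ phi D ε ⁻¹' tset D ε (w 1)).Nonempty with s
  simp [Sig]

theorem isSFT_setOf_forall_word [Finite (Letter D ε)] {n : ℕ} (p : Word D ε n → Prop) :
    IsSFT {s : ℤ → Letter D ε | ∀ k : ℤ, p (word (shift k s) n)} := by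
  have hlt (i : Icc (-(n : ℤ)) n) : ((i : ℤ) + n).toNat < 2 * n + 1 := by
    have := i.2.2
    lia
  convert isSFT_setOf_forall_window fun w : Fin (2 * n + 1) → Letter D ε =>
    p fun i => w ⟨((i : ℤ) + n).toNat, hlt i⟩ using 1
  ext s
  refine (Equiv.subRight (n : ℤ)).forall_congr fun {k} => ?_
  have hword : word (shift k s) n =
      fun i : Icc (-(n : ℤ)) n => s (k - n + ((i : ℤ) + n).toNat) := by
    funext i
    have := i.2.1
    exact congrArg s (by lia)
  exact iff_of_eq (congrArg p hword)

theorem not_closure_cell_subset_U (hD : 1 < D) (hsq : Squarefree D) (hU : 1 < unitU D ε)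
    (hfund : D = 5 → IsFundamentalUnit D ε) {t : ℝ} {s : ℤ → Letter D ε}
    (hs : s ∈ piInv D ε (X D t)) (n : ℕ) (I : Finset (O D)) :
    ¬ closure (cell D ε n (word s n)) ⊆ U D t I := by
  intro hsub
  obtain ⟨x, hpi, hx⟩ := exists_lift_piMap hD hsq hU hfund hs.1
  obtain ⟨q, -, hq⟩ := hsub (hx n)
  have hlt : euclMin D (piMap D ε s) < t :=
    hpi ▸ euclMin_proj_lt_iff.mpr ⟨_, embed_mem_lattice q, hq⟩
  exact hlt.not_ge hs.2

theorem piInv_X_subset_avoid_Tn (hD : 1 < D) (hsq : Squarefree D) (hU : 1 < unitU D ε)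
    (hfund : D = 5 → IsFundamentalUnit D ε) (n : ℕ) (t : ℝ) (I : Finset (O D)) :
    piInv D ε (X D t) ⊆ avoid D ε (Tn D ε n t I) := by
  refine fun s hs => ⟨hs.1, ?_⟩
  rintro m w ⟨-, hw⟩ ⟨k, hk⟩
  obtain rfl : word (shift k s) m = w := funext hk
  exact not_closure_cell_subset_U hD hsq hU hfund
    (shift_mem_piInv_X hD hsq hU hfund hs k) m I hw

theorem avoid_Tn_subset (hD : 1 < D) (hsq : Squarefree D) (hU : 1 < unitU D ε) (n : ℕ) (t : ℝ)
    (I : Finset (O D)) : avoid D ε (Tn D ε n t I) ⊆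
      Sig D ε ∩ {s | ∀ k, ¬ closure (cell D ε n (word (shift k s) n)) ⊆ U D t I} :=
  fun _ ⟨hs, havoid⟩ => ⟨hs, fun k hk => havoid n _
    ⟨⟨cell_nonempty hD hsq hU (shift_mem_Sig hs k) n, _, rfl⟩, hk⟩ ⟨k, fun _ => rfl⟩⟩

theorem euclMin_proj_lt_of_norm_le {v : ℝ × ℝ} {a : ℝ} (hv : ‖v‖ ≤ a) :
    euclMin D (proj D v) < a ^ 2 + 1 := by
  refine euclMin_proj_lt_iff.mpr ⟨0, zero_mem _, ?_⟩
  rw [sub_zero]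
  calc absNorm v ≤ ‖v‖ ^ 2 := absNorm_le_sq v
    _ ≤ a ^ 2 := by gcongr
    _ < a ^ 2 + 1 := lt_add_one _

-- Applying a power of `ε` balances the two coordinates of the difference `x - q`, so that the
-- norm inequality is witnessed by a lattice point at bounded distance.
theorem exists_shift_lift_near_lattice (hD : 1 < D) (hsq : Squarefree D) (hU : 1 < unitU D ε)
    (hfund : D = 5 → IsFundamentalUnit D ε) {r : ℝ} {s : ℤ → Letter D ε} (hs : s ∈ Sig D ε)
    (hr : euclMin D (piMap D ε s) < r) :
    ∃ (k : ℤ) (y : ℝ × ℝ) (p : O D),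
      (∀ n, y ∈ closure (cell D ε n (word (shift k s) n))) ∧
        ‖y - embed D p‖ ≤ unitU D ε + (al D ^ 2 + 1) ∧ absNorm (y - embed D p) < r := by
  obtain ⟨x, hx, hxcl⟩ := exists_lift_piMap hD hsq hU hfund hs
  have hsmall : euclMin D (proj D x) < al D ^ 2 + 1 :=
    euclMin_proj_lt_of_norm_le (norm_le_of_mem_closure_cell hD hsq (hxcl 0))
  rw [hx] at hr
  obtain ⟨q, hq, hxq⟩ := euclMin_proj_lt_iff.mp (lt_min hr hsmall)
  obtain ⟨hxqr, hxqa⟩ := lt_min_iff.mp hxq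
  obtain ⟨k, hk⟩ := exists_norm_phiV_zpow_le hU (x - q)
  obtain ⟨y, hy, hycl⟩ := exists_lift_piMap hD hsq hU hfund (shift_mem_Sig hs k)
  rw [piMap_shift hD hsq hU hfund hs, hx, phi_zpow_proj, proj_eq_proj_iff] at hy
  obtain ⟨p, hp⟩ := exists_embed_eq (add_mem hy (phiV_mem_lattice (ε := ε ^ k) hq))
  have hyp : y - embed D p = phiV D (ε ^ k) (x - q) := by
    rw [hp, map_sub]
    abel
  refine ⟨k, y, p, hycl, ?_, ?_⟩ <;> rw [hyp]
  · exact hk.trans (by gcongr)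
  · rwa [absNorm_phiV]

theorem absNorm_lt_of_norm_sub_le {v w : ℝ × ℝ} {B δ η t : ℝ} (hw : ‖w‖ ≤ B)
    (hwt : absNorm w < t - η) (hvw : ‖v - w‖ ≤ δ) (hδ : δ ≤ 1) (hδη : δ * (2 * B + 1) ≤ η) :
    absNorm v < t := by
  have hδ0 : 0 ≤ δ := (norm_nonneg _).trans hvw
  calc absNorm v = absNorm (w + (v - w)) := by rw [add_sub_cancel]
    _ ≤ absNorm w + ‖v - w‖ * (2 * ‖w‖ + ‖v - w‖) := absNorm_add_le _ _
    _ ≤ absNorm w + δ * (2 * B + 1) := by gcongr; exact hvw.trans hδ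
    _ < t := by linarith

theorem finite_setOf_norm_embed_le (hD : 1 < D) (hsq : Squarefree D) (C : ℝ) :
    {q : O D | ‖embed D q‖ ≤ C}.Finite :=
  ((finite_setOf_mem_lattice_norm_le hD hsq C).preimage
    ((embed_injective (by lia)).comp Subtype.val_injective).injOn).subset
      fun q hq => ⟨embed_mem_lattice q, hq⟩

theorem exists_finset_closure_cell_subset_U (hD : 1 < D) (hsq : Squarefree D)
    (hU : 1 < unitU D ε) (hfund : D = 5 → IsFundamentalUnit D ε) :
    ∃ I_K : Finset (O D), ∀ η > 0, ∃ n, ∀ I, I_K ⊆ I → ∀ t, ∀ s ∈ Sig D ε,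
      euclMin D (piMap D ε s) < t - η →
        ∃ k, closure (cell D ε n (word (shift k s) n)) ⊆ U D t I := by
  set B : ℝ := unitU D ε + (al D ^ 2 + 1)
  have hfin := finite_setOf_norm_embed_le hD hsq (al D + B)
  refine ⟨hfin.toFinset, fun η hη => ?_⟩
  have hlim := tendsto_const_mul_inv_unitU_pow hU (2 * al D)
  have hlim' := hlim.mul_const (2 * B + 1)
  rw [zero_mul] at hlim'
  obtain ⟨n, hn, hn'⟩ :=
    ((hlim.eventually_le_const one_pos).and (hlim'.eventually_le_const hη)).exists
  refine ⟨n, fun I hI t s hs hst => ?_⟩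
  obtain ⟨k, y, p, hy, hnorm, hlt⟩ := exists_shift_lift_near_lattice hD hsq hU hfund hs hst
  have hp : ‖embed D p‖ ≤ al D + B := by
    rw [← sub_sub_cancel y (embed D p)]
    exact norm_sub_le_of_le (norm_le_of_mem_closure_cell hD hsq (hy n)) hnorm
  refine ⟨k, fun z hz => ⟨p, hI (hfin.mem_toFinset.mpr hp), ?_⟩⟩
  refine absNorm_lt_of_norm_sub_le hnorm hlt ?_ hn hn'
  rw [sub_sub_sub_cancel_right, ← dist_eq_norm]
  exact dist_le_of_mem_closure_cell hD hsq hU hfund hz (hy n)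

end QuadTorus

end

open QuadTorus in
theorem proposition3_general (D : ℕ) (hD : 1 < D) (hsq : Squarefree D)
    (ε : (O D)ˣ) (hε : 1 < realEmb D (ε : O D)) (hfund : D = 5 → IsFundamentalUnit D ε) :
    ∃ I_K : Finset (O D), ∀ I : Finset (O D), I_K ⊆ I →
      ∀ t η : ℝ, 0 < η → X D t = X D (t - η) →
        IsSFT (piInv D ε (X D t)) ∧
          ∃ n : ℕ, piInv D ε (X D t) = avoid D ε (Tn D ε n t I) := by
  have : Finite (Letter D ε) := (finite_P0 hD hsq hε).to_subtype
  obtain ⟨I_K, hI_K⟩ := exists_finset_closure_cell_subset_U hD hsq hε hfund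
  refine ⟨I_K, fun I hI t η hη hX => ?_⟩
  obtain ⟨n, hn⟩ := hI_K η hη
  let Y : Set (ℤ → Letter D ε) :=
    Sig D ε ∩ {s | ∀ k, ¬ closure (cell D ε n (word (shift k s) n)) ⊆ U D t I}
  have hpi : piInv D ε (X D t) ⊆ avoid D ε (Tn D ε n t I) :=
    piInv_X_subset_avoid_Tn hD hsq hε hfund n t I
  have havoid : avoid D ε (Tn D ε n t I) ⊆ Y := avoid_Tn_subset hD hsq hε n t I
  have hY : Y ⊆ piInv D ε (X D t) := by
    rintro s ⟨hs, huncovered⟩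
    have hle : t - η ≤ euclMin D (piMap D ε s) := by
      by_contra! hlt
      obtain ⟨k, hk⟩ := hn I hI t s hs hlt
      exact huncovered k hk
    exact hX ▸ ⟨hs, hle⟩
  refine ⟨?_, n, hpi.antisymm (havoid.trans hY)⟩
  rw [(hpi.trans havoid).antisymm hY]
  exact isSFT_Sig.inter (isSFT_setOf_forall_word fun w => ¬ closure (cell D ε n w) ⊆ U D t I)

open QuadTorus in
theorem proposition3 (D : ℕ) (hD : 1 < D) (hsq : Squarefree D)
    (ε : (O D)ˣ) (hε : IsFundamentalUnit D ε) :
    ∃ I_K : Finset (O D), ∀ I : Finset (O D), I_K ⊆ I →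
      ∀ t η : ℝ, 0 < t → 0 < η → X D t = X D (t - η) →
        IsSFT (piInv D ε (X D t)) ∧
          ∃ n : ℕ, piInv D ε (X D t) = avoid D ε (Tn D ε n t I) := by
  obtain ⟨I_K, h⟩ := proposition3_general D hD hsq ε hε.1 fun _ => hε
  exact ⟨I_K, fun I hI t η _ => h I hI t η⟩
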